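/- **Conventions.** Let $B_{48}$ be the braid group with Artin generators $\sigma_1,\dots,\sigma_{47}$, acting on $48$ real points $1<1'<2<2'<\dots<24<24'$; $\sigma_k$ is the counterclockwise halftwist of the $k$-th and $(k+1)$-st point along the segment between them, products are read from left to right, and $a^b=b^{-1}ab$. For two of the points $a<b$, $Z_{ab}$ (resp. $\bar Z_{ab}$) is the counterclockwise halftwist along the path from $a$ to $b$ below (resp. above) the real axis, and $Z^{(P)}_{ab}$ the one along the path above the points of $P$ and below the other points between $a$ and $b$; so $Z_{ab}=w^{-1}\sigma_a w$ with $w=\sigma_{a+1}\cdots\sigma_{b-1}$ in terms of positions, with $\sigma_k^{-1}$ in place of $\sigma_k$ when the point at position $k$ is passed above. A factorized expression in a group is a finite sequence $g_1\cdots g_k$ of elements; $(g_1\cdots g_k)^b=g_1^b\cdots g_k^b$. It is *invariant under $h$* if it can be transformed into $(g_1\cdots g_k)^h$ by finitely many Hurwitz moves, which replace two neighbouring factors $a,b$ by $aba^{-1},a$ or by $b,b^{-1}ab$. The following are factorized expressions (as exponents of a conjugation they denote their products): $Z^2_{ii',j}=Z^2_{i'j}Z^2_{ij}$, $Z^2_{i,jj'}=Z^2_{ij'}Z^2_{ij}$,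 $Z^2_{ii',jj'}=Z^2_{i',jj'}Z^2_{i,jj'}$ (also along paths above a set $P$), $\bar Z^2_{i,jj'}=\bar Z^2_{ij}\bar Z^2_{ij'}$, $\bar Z^2_{ii',jj'}=\bar Z^2_{i,jj'}\bar Z^2_{i',jj'}$, $Z^3_{i,jj'}=(Z^3_{ij})^{Z_{jj'}}\cdot Z^3_{ij}\cdot(Z^3_{ij})^{Z_{jj'}^{-1}}$, $Z^3_{ii',j}=(Z^3_{ij})^{Z_{ii'}}\cdot Z^3_{ij}\cdot(Z^3_{ij})^{Z_{ii'}^{-1}}$, and likewise with bars; $i$ or $j$ may be replaced by $i'$ or $j'$ when it is a single point. Put $R_{ij}=Z^{(i')}_{ij'}\cdot Z_{i'j}$ (a pair of halftwists). **3-points.** For $(m;i,j,k)=(1;1,3,19),(3;2,6,14),(6;7,10,17),(8;11,12,24)$, $$\varphi_m=Z^3_{jj',k}\cdot(Z_{i'j'}\cdot Z_{i'j'}\cdot Z_{ij'}\cdot Z_{ij'}\cdot Z_{i'j}\cdot Z_{i'j}\cdot Z_{ij}\cdot Z_{ij})^{Z^2_{jj',k}}\cdot Z^3_{ii',k}\cdot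 Z_{kk'}^{Z^2_{jj',k}Z^2_{ii',k}}.$$ **6-points.** For lines $i<j<k<l$ put $$F^1_{ijkl}=Z^3_{jj',k}\cdot Z^2_{k'l}\cdot(Z^2_{kl})^{Z^2_{jj',k}}\cdot(Z^3_{jj',l})^{Z^2_{jj',k}}\cdot R_{ij}^{\,Z^2_{jj',k}\cdot(Z^2_{jj',l})^{Z^2_{jj',k}}},$$ $$F^2_{ijkl}=Z^2_{i'j}\cdot Z^3_{j',kk'}\cdot(Z^2_{i'j'})^{Z^2_{j',kk'}Z^2_{i'j}}\cdot(Z^3_{i',kk'})^{Z^2_{i'j}}\cdot R_{kl}^{\,Z^2_{j',kk'}\cdot(Z^2_{i',kk'})^{Z^2_{i'j}}},$$ $$F^3_{ijkl}=Z^3_{i',jj'}\cdot Z^3_{kk',l}\cdot R_{jk}^{\,Z^2_{i',jj'}Z^2_{kk',l}}\cdot(Z^2_{i'l})^{Z^2_{i',jj'}}\cdot Z^2_{il},$$ and for $F=F^r_{\dots}$ and two lines $a,b$ let $[F]_{a,b}=F\cdot F^{Z_{bb'}^{-1}Z_{aa'}^{-1}}$. Then $\varphi_2=Z^2_{22',4}\cdot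 Z^2_{4',55'}\cdot Z^3_{11',4}\cdot(Z^3_{4',13\,13'})^{Z^2_{4',55'}}\cdot(Z^2_{22',4})^{Z^2_{11',4}}\cdot(Z^2_{4',55'})^{Z^{-2}_{55',13\,13'}}\cdot Z_{44'}^{Z^2_{4',13\,13'}Z^2_{4',55'}Z^2_{22',4}Z^2_{11',4}}\cdot(Z^2_{4,20\,20'})^{Z^2_{4,13\,13'}Z^2_{4,55'}Z^2_{44'}Z^2_{22',4}Z^2_{11',4}}\cdot(Z^2_{4',20\,20'})^{Z^2_{4',13\,13'}Z^2_{4',55'}}\cdot\bigl(G\cdot[F^1_{1,2,13,20}]_{13,20}^{Z^2_{22',5}Z^2_{11',5}}\bigr)^{Z^2_{22',4}Z^2_{11',4}}$, where $G=Z^2_{5',13\,13'}\cdot Z^3_{22',5}\cdot(Z^3_{5',20\,20'})^{Z^2_{5',13\,13'}}\cdot(Z^2_{5',13\,13'})^{Z^{-2}_{13\,13',20\,20'}}\cdot Z_{55'}^{Z^2_{22',5}Z^2_{5',20\,20'}Z^2_{5',13\,13'}}\cdot(Z^2_{11',5'})^{Z^2_{5',20\,20'}Z^2_{5',13\,13'}}\cdot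 Z^2_{11',5}$; $\varphi_4=Z^2_{4',77'}\cdot(Z^2_{4',88'})^{Z^2_{4',77'}}\cdot Z^3_{33',4}\cdot(Z^3_{4',15\,15'})^{Z^2_{4',88'}Z^2_{4',77'}}\cdot(Z^2_{4',88'})^{Z^2_{4',77'}Z^{-2}_{88',15\,15'}}\cdot(Z^2_{4',77'})^{Z^{-2}_{77',88'}Z^{-2}_{77',15\,15'}}\cdot Z_{44'}^{Z^2_{33',4}Z^2_{4',15\,15'}Z^2_{4',88'}Z^2_{4',77'}}\cdot(Z^2_{4,21\,21'})^{Z^2_{4,15\,15'}Z^2_{4,88'}Z^2_{4,77'}Z^2_{44'}Z^2_{33',4}}\cdot(Z^2_{4',21\,21'})^{Z^2_{4',15\,15'}Z^2_{4',88'}Z^2_{4',77'}}\cdot\bigl(G\cdot[F^2_{3,7,15,21}]_{3,7}^{Z^2_{77',8}Z^2_{33',8}}\bigr)^{Z^2_{33',4}}$, where $G=Z^2_{8',15\,15'}\cdot Z^3_{77',8}\cdot(Z^3_{8',21\,21'})^{Z^2_{8',15\,15'}}\cdot(Z^2_{8',15\,15'})^{Z^{-2}_{15\,15',21\,21'}}\cdot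 Z_{88'}^{Z^2_{77',8}Z^2_{8',21\,21'}Z^2_{8',15\,15'}}\cdot(Z^2_{33',8'})^{Z^2_{8',21\,21'}Z^2_{8',15\,15'}}\cdot Z^2_{33',8}$; $\varphi_5=Z^3_{5',66'}\cdot G^{Z^2_{5',66'}}\cdot(Z^3_{5',22\,22'})^{Z^2_{5',66'}}\cdot Z_{55'}^{Z^2_{5',22\,22'}Z^2_{5',66'}}\cdot\prod_{k=16,11,9}\bigl((Z^2_{5,kk'})^{Z^2_{55'}Z^2_{5',66'}}\cdot(Z^2_{5',kk'})^{Z^2_{5',66'}}\bigr)$, where $G=Z^2_{66',9}\cdot Z^3_{9',11\,11'}\cdot(Z^2_{66',9'})^{Z^2_{66',9}Z^2_{9',11\,11'}}\cdot[F^2_{6,11,16,22}]_{6,11}^{Z^2_{66',99'}Z^2_{9',11\,11'}}\cdot(Z^2_{9',22\,22'})^{Z^2_{9',11\,11'}}\cdot Z^2_{9,22\,22'}\cdot(Z^3_{9',16\,16'})^{Z^2_{9',11\,11'}}\cdot Z_{99'}^{Z^2_{9',16\,16'}Z^2_{9',11\,11'}}$; $\varphi_7=Z^2_{88',9}\cdot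 Z^2_{9',10\,10'}\cdot(Z^3_{9',12\,12'})^{Z^2_{9',10\,10'}}\cdot(Z^2_{9',10\,10'})^{Z^{-2}_{10\,10',12\,12'}}\cdot(Z^2_{88',9'})^{Z^2_{9',12\,12'}Z^2_{9',10\,10'}Z^2_{88',9}}\cdot G^{Z^2_{88',99'}Z^2_{9',12\,12'}Z^2_{9',10\,10'}}\cdot(Z^2_{9',23\,23'})^{Z^2_{9',12\,12'}Z^2_{9',10\,10'}}\cdot(Z^3_{9',18\,18'})^{Z^2_{9',12\,12'}Z^2_{9',10\,10'}}\cdot Z^2_{9,23\,23'}\cdot Z_{99'}^{Z^2_{9',18\,18'}Z^2_{9',12\,12'}Z^2_{9',10\,10'}}$, where $G=Z^3_{8',10\,10'}\cdot[F^1_{10,12,18,23}]_{18,23}^{Z^2_{8',10\,10'}}\cdot(Z^3_{8',23\,23'})^{Z^2_{8',10\,10'}}\cdot Z_{88'}^{Z^2_{8',23\,23'}Z^2_{8',10\,10'}}\cdot\prod_{k=18,12}\bigl((Z^2_{8,kk'})^{Z^2_{88'}Z^2_{8',10\,10'}}\cdot(Z^2_{8',kk'})^{Z^2_{8',10\,10'}}\bigr)$;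 $\varphi_9=Z^2_{14',15\,15'}\cdot Z^3_{13\,13',14}\cdot\bar Z^3_{14',16\,16'}\cdot(Z^2_{14',15\,15'})^{Z^{-2}_{15\,15',16\,16'}}\cdot Z_{14\,14'}^{Z^2_{13\,13',14}Z^2_{14',16\,16'}Z^2_{14',15\,15'}}\cdot\prod_{k=17,18}\bigl((\bar Z^2_{14,kk'})^{Z^2_{13\,13',14}}\cdot\bar Z^2_{14',kk'}\bigr)\cdot\bigl(G\cdot[F^3_{13,15,16,18}]_{13,18}^{Z^{-2}_{17,18\,18'}}\bigr)^{Z^2_{13\,13',14}}$, where $G=Z^2_{16\,16',17}\cdot Z^3_{17',18\,18'}\cdot Z^3_{15\,15',17}\cdot(Z^2_{16\,16',17})^{Z^2_{15\,15',17}}\cdot Z_{17\,17'}^{Z^2_{17',18\,18'}Z^2_{16\,16',17}Z^2_{15\,15',17}}\cdot(Z^2_{13\,13',17'})^{Z^2_{17',18\,18'}}\cdot Z^2_{13\,13',17}$; $\varphi_{10}=Z^3_{19',20\,20'}\cdot Z_{24\,24'}^{Z^{-2}_{22\,22',24}Z^{-2}_{23\,23',24}}\cdot Z^2_{21\,21',24'}\cdot\bar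 Z^3_{22\,22',24}\cdot(Z^2_{21\,21',24})^{Z^{-2}_{23\,23',24}}\cdot G^{Z^2_{19',20\,20'}}\cdot Z^3_{23\,23',24}\cdot\bar Z^3_{19',21\,21'}\cdot Z^2_{19,24\,24'}\cdot Z^2_{19,23\,23'}\cdot Z^2_{19,22\,22'}\cdot Z_{19\,19'}^{Z^2_{19',21\,21'}Z^2_{19',20\,20'}}$, where $G=Z^2_{20\,20',24'}\cdot(Z^2_{20\,20',24})^{Z^{-2}_{23\,23',24}}\cdot[F^3_{20,21,22,23}]_{20,23}^{Z^{-2}_{23\,23',24}}\cdot Z^2_{19',24\,24'}\cdot Z^2_{19',23\,23'}\cdot Z^2_{19',22\,22'}$. **Parasitic intersections.** Number the lines $1,\dots,24$ by their end vertices: $12,23,14,24,25,35,46,47,57,67,58,78,29,39,49,59,69,79$ and $1\,10,\ 2\,10,\ 4\,10,\ 5\,10,\ 7\,10,\ 8\,10$. For a line $t$ let $P_t$ be the set of points $q,q'$ for the lines $q<t$ with the same larger vertex as $t$. Let $D_t=\prod_i Z^{2\,(P_t)}_{ii',tt'}$, in increasing order over the lines $i<t$ without a common vertex with $t$, and let $\bar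 D_t$ be the same product of the $\bar Z^2_{ii',tt'}$ along paths *below* the points of $P_t$ and above the other points. Let $C_j$ (resp. $\bar C_j$) be the product of the $D_t$ (resp. $\bar D_t$), in increasing order, over the lines $t$ with smaller vertex $j$. **Statement.** For all integers $m_1,m_3,m_4,m_6,m_{10},m_{13},m_{14},m_{15},m_{19}$ the factorization $$\Delta^2_{48}:\quad C_1\varphi_1\cdot C_2\varphi_2\cdots C_{10}\varphi_{10},$$ and likewise $\bar C_{10}\varphi_{10}\cdot\bar C_9\varphi_9\cdots\bar C_1\varphi_1$ (the form before complex conjugation of the parasitic braids), is invariant under $$\begin{aligned}\rho={}&(Z_{11'}Z_{22'})^{m_1}(Z_{66'}Z_{11\,11'})^{m_6}(Z_{10\,10'}Z_{12\,12'})^{m_{10}}(Z_{33'}Z_{77'})^{m_3}(Z_{14\,14'}Z_{17\,17'})^{m_{14}}(Z_{19\,19'}Z_{24\,24'})^{m_{19}}\\&(Z_{44'}Z_{55'}Z_{88'}Z_{99'})^{m_4}(Z_{13\,13'}Z_{18\,18'}Z_{20\,20'}Z_{23\,23'})^{m_{13}}(Z_{15\,15'}Z_{16\,16'}Z_{21\,21'}Z_{22\,22'})^{m_{15}}.\end{aligned}$$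 -/

import Mathlib

namespace K3Braid

/-! ### Hurwitz equivalence of factorized expressions -/

/-- The conjugate `x ^ b = b⁻¹ x b`. -/
def conj {G : Type*} [Group G] (x b : G) : G := b⁻¹ * x * b

/-- A factorized expression `g₁ ⋯ gₖ` in a group is the list `[g₁, …, gₖ]`; this conjugates each
of its factors by `b`. -/
def conjList {G : Type*} [Group G] (l : List G) (b : G) : List G := l.map fun x => conj x b

/-- A single Hurwitz move on a pair of neighbouring factors. -/
inductive HurwitzMove {G : Type*} [Group G] : List G → List G → Prop
  | left (l r : List G) (a b : G) :
      HurwitzMove (l ++ [a, b] ++ r) (l ++ [a * b * a⁻¹, a] ++ r)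
  | right (l r : List G) (a b : G) :
      HurwitzMove (l ++ [a, b] ++ r) (l ++ [b, b⁻¹ * a * b] ++ r)

/-- Hurwitz equivalence: finitely many Hurwitz moves. -/
def HurwitzEquiv {G : Type*} [Group G] : List G → List G → Prop :=
  Relation.ReflTransGen HurwitzMove

/-- A factorized expression is invariant under `h` if it is Hurwitz equivalent to the expression
obtained by conjugating every factor by `h`. -/
def IsInvariantUnder {G : Type*} [Group G] (l : List G) (h : G) : Prop :=
  HurwitzEquiv l (conjList l h)

/-! ### The braid group -/

/-- Artin's relations on the generators `σ₁, …, σₙ₋₁` (indexed from `0`). -/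
def braidRels (n : ℕ) : Set (FreeGroup (Fin (n - 1))) :=
  {r | ∃ i j : Fin (n - 1), (i : ℕ) + 1 < j ∧
      r = .of i * .of j * (.of j * .of i)⁻¹} ∪
  {r | ∃ i j : Fin (n - 1), (i : ℕ) + 1 = j ∧
      r = .of i * .of j * .of i * (.of j * .of i * .of j)⁻¹}

/-- The braid group on `n` strands. A product is read from left to right. -/
abbrev BraidGroup (n : ℕ) : Type := PresentedGroup (braidRels n)

/-- The braid group on the `48` points `1 < 1' < 2 < 2' < ⋯ < 24 < 24'` of the typical fibre. They
sit at the positions `1, …, 48` of the real line: `j` at `2 j - 1` and `j'` at `2 j`. -/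
abbrev B : Type := BraidGroup 48

/-- `σ k`, for `1 ≤ k ≤ 47`, is the counterclockwise halftwist of the points at the positions
`k` and `k + 1` along the real segment between them. -/
def σ (k : ℕ) : B := if h : k - 1 < 48 - 1 then PresentedGroup.of ⟨k - 1, h⟩ else 1

/-! ### Halftwists -/

/-- The counterclockwise halftwist of the points at the positions `a < b`, along the path which
passes above the positions `k` between them with `above k = true`, and below the others.
Moving the right end of a path over one place by `σ k` lets the path pass below the point that is
now at `k`, and moving it by `(σ k)⁻¹` lets it pass above. -/
def halfTwist (above : ℕ → Bool) (a b : ℕ) : B :=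
  conj (σ a) ((List.Ico (a + 1) b).map fun k => bif above k then (σ k)⁻¹ else σ k).prod

/-- `Z_{ab}`: the path is below the real axis. -/
def Z (a b : ℕ) : B := halfTwist (fun _ => false) a b

/-- `Z̄_{ab}`: the path is above the real axis. -/
def Zbar (a b : ℕ) : B := halfTwist (fun _ => true) a b

/-- The position of the point `j`. -/
def u (j : ℕ) : ℕ := 2 * j - 1

/-- The position of the point `j'`. -/
def v (j : ℕ) : ℕ := 2 * j

/-- `Z_{j j'}`. -/
def T (j : ℕ) : B := Z (u j) (v j)

/-- The single point `j`, as an index of a regenerated braid. -/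
def pt (j : ℕ) : List ℕ := [u j]

/-- The single point `j'`, as an index of a regenerated braid. -/
def pt' (j : ℕ) : List ℕ := [v j]

/-- The doubled point `j j'`, as an index of a regenerated braid. -/
def dbl (j : ℕ) : List ℕ := [v j, u j]

/- `l ↗ b` conjugates each factor of `l` by `b`. It binds weaker than `*`, stronger than `++`. -/
infixl:67 " ↗ " => conjList

/-! ### Regenerated factors -/

/-- `Z²_{x,y}` as a factorized expression in fulltwists of two points, where each of `x`, `y` is a
single or a doubled point: `Z²_{ii',j} = Z²_{i'j} Z²_{ij}`, `Z²_{i,jj'} = Z²_{ij'} Z²_{ij}`,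
`Z²_{ii',jj'} = Z²_{i',jj'} Z²_{i,jj'}`. The paths pass above the positions in `above`. -/
def nodesAlong (above : ℕ → Bool) (x y : List ℕ) : List B :=
  x.flatMap fun a => y.map fun b => halfTwist above a b ^ 2

/-- `Z²_{x,y}` as a factorized expression, with paths below the real axis. -/
def Z2 (x y : List ℕ) : List B := nodesAlong (fun _ => false) x y

/-- `Z²_{x,y}` as a braid. -/
def full (x y : List ℕ) : B := (Z2 x y).prod

/-- `Z̄²_{x,y}` as a factorized expression. Along paths above the real axis the order is
`Z̄²_{i,jj'} = Z̄²_{ij} Z̄²_{ij'}`. -/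
def Z2bar (x y : List ℕ) : List B := nodesAlong (fun _ => true) x.reverse y.reverse

/-- The three cusps `(z³)^{t} · z³ · (z³)^{t⁻¹}` to which `z⁴` regenerates. -/
def cusps (z t : B) : List B := [conj (z ^ 3) t, z ^ 3, conj (z ^ 3) t⁻¹]

/-- `Z³_{ii',b}`, where `b` is the position of a single point. -/
def Z3l (i b : ℕ) : List B := cusps (Z (u i) b) (T i)

/-- `Z³_{a,jj'}`, where `a` is the position of a single point. -/
def Z3r (a j : ℕ) : List B := cusps (Z a (u j)) (T j)

/-- `Z̄³_{ii',b}`, where `b` is the position of a single point. -/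
def Z3lbar (i b : ℕ) : List B := cusps (Zbar (u i) b) (T i)

/-- `Z̄³_{a,jj'}`, where `a` is the position of a single point. -/
def Z3rbar (a j : ℕ) : List B := cusps (Zbar a (u j)) (T j)

/-- The regeneration `Z_{ij'} · Z_{i'j}` of a halftwist `Z_{ij}`. The path of the first factor
passes above `i'` and below all the other points between its ends, that of the second one passes
below all of them. -/
def branchPair (i j : ℕ) : List B :=
  [halfTwist (fun k => decide (k = v i)) (u i) (v j), Z (v i) (u j)]

/-! ### 3-points -/

/-- The local braid monodromy of a 3-point with lines `i < j < k`. -/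
def phi3 (i j k : ℕ) : List B :=
  Z3l j (u k)
  ++ [Z (v i) (v j), Z (v i) (v j), Z (u i) (v j), Z (u i) (v j),
      Z (v i) (u j), Z (v i) (u j), Z (u i) (u j), Z (u i) (u j)] ↗ full (dbl j) (pt k)
  ++ Z3l i (u k)
  ++ [T k] ↗ full (dbl j) (pt k) * full (dbl i) (pt k)

/-! ### 6-points

In each of the factorizations `F` below, the last ingredient `Z̃_{ab'} · Z̃_{a'b}` is the
regeneration of `Z_{ab}` conjugated by the fulltwists of the tangencies (the factors of degree 3)
of `F`, in the order in which these occur. -/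

/-- `F` for the 6-points `2` and `7`. -/
def F₁ (i j k l : ℕ) : List B :=
  Z3l j (u k)
  ++ Z2 (pt' k) (pt l)
  ++ Z2 (pt k) (pt l) ↗ full (dbl j) (pt k)
  ++ Z3l j (u l) ↗ full (dbl j) (pt k)
  ++ branchPair i j ↗
      full (dbl j) (pt k) * conj (full (dbl j) (pt l)) (full (dbl j) (pt k))

/-- `F` for the 6-points `4` and `5`. -/
def F₂ (i j k l : ℕ) : List B :=
  Z2 (pt' i) (pt j)
  ++ Z3r (v j) k
  ++ Z2 (pt' i) (pt' j) ↗ full (pt' j) (dbl k) * full (pt' i) (pt j)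
  ++ Z3r (v i) k ↗ full (pt' i) (pt j)
  ++ branchPair k l ↗
      full (pt' j) (dbl k) * conj (full (pt' i) (dbl k)) (full (pt' i) (pt j))

/-- `F` for the 6-points `9` and `10`. -/
def F₃ (i j k l : ℕ) : List B :=
  Z3r (v i) j
  ++ Z3l k (u l)
  ++ branchPair j k ↗ full (pt' i) (dbl j) * full (dbl k) (pt l)
  ++ Z2 (pt' i) (pt l) ↗ full (pt' i) (dbl j)
  ++ Z2 (pt i) (pt l)

/-- `F · F^{Z_{bb'}⁻¹ Z_{aa'}⁻¹}`. -/
def twice (F : List B) (a b : ℕ) : List B := F ++ F ↗ (T b)⁻¹ * (T a)⁻¹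

def phi2 : List B :=
  Z2 (dbl 2) (pt 4)
  ++ Z2 (pt' 4) (dbl 5)
  ++ Z3l 1 (u 4)
  ++ Z3r (v 4) 13 ↗ full (pt' 4) (dbl 5)
  ++ Z2 (dbl 2) (pt 4) ↗ full (dbl 1) (pt 4)
  ++ Z2 (pt' 4) (dbl 5) ↗ (full (dbl 5) (dbl 13))⁻¹
  ++ [T 4] ↗ full (pt' 4) (dbl 13) * full (pt' 4) (dbl 5) * full (dbl 2) (pt 4)
      * full (dbl 1) (pt 4)
  ++ Z2 (pt 4) (dbl 20) ↗ full (pt 4) (dbl 13) * full (pt 4) (dbl 5) * T 4 ^ 2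
      * full (dbl 2) (pt 4) * full (dbl 1) (pt 4)
  ++ Z2 (pt' 4) (dbl 20) ↗ full (pt' 4) (dbl 13) * full (pt' 4) (dbl 5)
  ++ (G ++ twice (F₁ 1 2 13 20) 13 20 ↗ full (dbl 2) (pt 5) * full (dbl 1) (pt 5))
      ↗ full (dbl 2) (pt 4) * full (dbl 1) (pt 4)
where
  G : List B :=
    Z2 (pt' 5) (dbl 13)
    ++ Z3l 2 (u 5)
    ++ Z3r (v 5) 20 ↗ full (pt' 5) (dbl 13)
    ++ Z2 (pt' 5) (dbl 13) ↗ (full (dbl 13) (dbl 20))⁻¹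
    ++ [T 5] ↗ full (dbl 2) (pt 5) * full (pt' 5) (dbl 20) * full (pt' 5) (dbl 13)
    ++ Z2 (dbl 1) (pt' 5) ↗ full (pt' 5) (dbl 20) * full (pt' 5) (dbl 13)
    ++ Z2 (dbl 1) (pt 5)

def phi4 : List B :=
  Z2 (pt' 4) (dbl 7)
  ++ Z2 (pt' 4) (dbl 8) ↗ full (pt' 4) (dbl 7)
  ++ Z3l 3 (u 4)
  ++ Z3r (v 4) 15 ↗ full (pt' 4) (dbl 8) * full (pt' 4) (dbl 7)
  ++ Z2 (pt' 4) (dbl 8) ↗ full (pt' 4) (dbl 7) * (full (dbl 8) (dbl 15))⁻¹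
  ++ Z2 (pt' 4) (dbl 7) ↗ (full (dbl 7) (dbl 8))⁻¹ * (full (dbl 7) (dbl 15))⁻¹
  ++ [T 4] ↗ full (dbl 3) (pt 4) * full (pt' 4) (dbl 15) * full (pt' 4) (dbl 8)
      * full (pt' 4) (dbl 7)
  ++ Z2 (pt 4) (dbl 21) ↗ full (pt 4) (dbl 15) * full (pt 4) (dbl 8) * full (pt 4) (dbl 7)
      * T 4 ^ 2 * full (dbl 3) (pt 4)
  ++ Z2 (pt' 4) (dbl 21) ↗ full (pt' 4) (dbl 15) * full (pt' 4) (dbl 8) * full (pt' 4) (dbl 7)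
  ++ (G ++ twice (F₂ 3 7 15 21) 3 7 ↗ full (dbl 7) (pt 8) * full (dbl 3) (pt 8))
      ↗ full (dbl 3) (pt 4)
where
  G : List B :=
    Z2 (pt' 8) (dbl 15)
    ++ Z3l 7 (u 8)
    ++ Z3r (v 8) 21 ↗ full (pt' 8) (dbl 15)
    ++ Z2 (pt' 8) (dbl 15) ↗ (full (dbl 15) (dbl 21))⁻¹
    ++ [T 8] ↗ full (dbl 7) (pt 8) * full (pt' 8) (dbl 21) * full (pt' 8) (dbl 15)
    ++ Z2 (dbl 3) (pt' 8) ↗ full (pt' 8) (dbl 21) * full (pt' 8) (dbl 15)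
    ++ Z2 (dbl 3) (pt 8)

def phi5 : List B :=
  Z3r (v 5) 6
  ++ G ↗ full (pt' 5) (dbl 6)
  ++ Z3r (v 5) 22 ↗ full (pt' 5) (dbl 6)
  ++ [T 5] ↗ full (pt' 5) (dbl 22) * full (pt' 5) (dbl 6)
  ++ Z2 (pt 5) (dbl 16) ↗ T 5 ^ 2 * full (pt' 5) (dbl 6)
  ++ Z2 (pt' 5) (dbl 16) ↗ full (pt' 5) (dbl 6)
  ++ Z2 (pt 5) (dbl 11) ↗ T 5 ^ 2 * full (pt' 5) (dbl 6)
  ++ Z2 (pt' 5) (dbl 11) ↗ full (pt' 5) (dbl 6)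
  ++ Z2 (pt 5) (dbl 9) ↗ T 5 ^ 2 * full (pt' 5) (dbl 6)
  ++ Z2 (pt' 5) (dbl 9) ↗ full (pt' 5) (dbl 6)
where
  G : List B :=
    Z2 (dbl 6) (pt 9)
    ++ Z3r (v 9) 11
    ++ Z2 (dbl 6) (pt' 9) ↗ full (dbl 6) (pt 9) * full (pt' 9) (dbl 11)
    ++ twice (F₂ 6 11 16 22) 6 11 ↗ full (dbl 6) (dbl 9) * full (pt' 9) (dbl 11)
    ++ Z2 (pt' 9) (dbl 22) ↗ full (pt' 9) (dbl 11)
    ++ Z2 (pt 9) (dbl 22)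
    ++ Z3r (v 9) 16 ↗ full (pt' 9) (dbl 11)
    ++ [T 9] ↗ full (pt' 9) (dbl 16) * full (pt' 9) (dbl 11)

def phi7 : List B :=
  Z2 (dbl 8) (pt 9)
  ++ Z2 (pt' 9) (dbl 10)
  ++ Z3r (v 9) 12 ↗ full (pt' 9) (dbl 10)
  ++ Z2 (pt' 9) (dbl 10) ↗ (full (dbl 10) (dbl 12))⁻¹
  ++ Z2 (dbl 8) (pt' 9) ↗ full (pt' 9) (dbl 12) * full (pt' 9) (dbl 10) * full (dbl 8) (pt 9)
  ++ G ↗ full (dbl 8) (dbl 9) * full (pt' 9) (dbl 12) * full (pt' 9) (dbl 10)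
  ++ Z2 (pt' 9) (dbl 23) ↗ full (pt' 9) (dbl 12) * full (pt' 9) (dbl 10)
  ++ Z3r (v 9) 18 ↗ full (pt' 9) (dbl 12) * full (pt' 9) (dbl 10)
  ++ Z2 (pt 9) (dbl 23)
  ++ [T 9] ↗ full (pt' 9) (dbl 18) * full (pt' 9) (dbl 12) * full (pt' 9) (dbl 10)
where
  G : List B :=
    Z3r (v 8) 10
    ++ twice (F₁ 10 12 18 23) 18 23 ↗ full (pt' 8) (dbl 10)
    ++ Z3r (v 8) 23 ↗ full (pt' 8) (dbl 10)
    ++ [T 8] ↗ full (pt' 8) (dbl 23) * full (pt' 8) (dbl 10)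
    ++ Z2 (pt 8) (dbl 18) ↗ T 8 ^ 2 * full (pt' 8) (dbl 10)
    ++ Z2 (pt' 8) (dbl 18) ↗ full (pt' 8) (dbl 10)
    ++ Z2 (pt 8) (dbl 12) ↗ T 8 ^ 2 * full (pt' 8) (dbl 10)
    ++ Z2 (pt' 8) (dbl 12) ↗ full (pt' 8) (dbl 10)

def phi9 : List B :=
  Z2 (pt' 14) (dbl 15)
  ++ Z3l 13 (u 14)
  ++ Z3rbar (v 14) 16
  ++ Z2 (pt' 14) (dbl 15) ↗ (full (dbl 15) (dbl 16))⁻¹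
  ++ [T 14] ↗ full (dbl 13) (pt 14) * full (pt' 14) (dbl 16) * full (pt' 14) (dbl 15)
  ++ Z2bar (pt 14) (dbl 17) ↗ full (dbl 13) (pt 14)
  ++ Z2bar (pt' 14) (dbl 17)
  ++ Z2bar (pt 14) (dbl 18) ↗ full (dbl 13) (pt 14)
  ++ Z2bar (pt' 14) (dbl 18)
  ++ (G ++ twice (F₃ 13 15 16 18) 13 18 ↗ (full (pt 17) (dbl 18))⁻¹) ↗ full (dbl 13) (pt 14)
where
  G : List B :=
    Z2 (dbl 16) (pt 17)
    ++ Z3r (v 17) 18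
    ++ Z3l 15 (u 17)
    ++ Z2 (dbl 16) (pt 17) ↗ full (dbl 15) (pt 17)
    ++ [T 17] ↗ full (pt' 17) (dbl 18) * full (dbl 16) (pt 17) * full (dbl 15) (pt 17)
    ++ Z2 (dbl 13) (pt' 17) ↗ full (pt' 17) (dbl 18)
    ++ Z2 (dbl 13) (pt 17)

def phi10 : List B :=
  Z3r (v 19) 20
  ++ [T 24] ↗ (full (dbl 22) (pt 24))⁻¹ * (full (dbl 23) (pt 24))⁻¹
  ++ Z2 (dbl 21) (pt' 24)
  ++ Z3lbar 22 (u 24)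
  ++ Z2 (dbl 21) (pt 24) ↗ (full (dbl 23) (pt 24))⁻¹
  ++ G ↗ full (pt' 19) (dbl 20)
  ++ Z3l 23 (u 24)
  ++ Z3rbar (v 19) 21
  ++ Z2 (pt 19) (dbl 24)
  ++ Z2 (pt 19) (dbl 23)
  ++ Z2 (pt 19) (dbl 22)
  ++ [T 19] ↗ full (pt' 19) (dbl 21) * full (pt' 19) (dbl 20)
where
  G : List B :=
    Z2 (dbl 20) (pt' 24)
    ++ Z2 (dbl 20) (pt 24) ↗ (full (dbl 23) (pt 24))⁻¹
    ++ twice (F₃ 20 21 22 23) 20 23 ↗ (full (dbl 23) (pt 24))⁻¹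
    ++ Z2 (pt' 19) (dbl 24)
    ++ Z2 (pt' 19) (dbl 23)
    ++ Z2 (pt' 19) (dbl 22)

/-- The local braid monodromies `φ₁, …, φ₁₀`. -/
def phi : ℕ → List B
  | 1 => phi3 1 3 19
  | 2 => phi2
  | 3 => phi3 2 6 14
  | 4 => phi4
  | 5 => phi5
  | 6 => phi3 7 10 17
  | 7 => phi7
  | 8 => phi3 11 12 24
  | 9 => phi9
  | 10 => phi10
  | _ => []

/-! ### Parasitic intersections -/

/-- The lines `p < t` that do not meet the line `t` (written as pairs of vertices, the lines
`p` and `t` have no end in common), in increasing order. -/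
def disjointLines : ℕ → List ℕ
  | 3 => [2]
  | 5 => [3]
  | 6 => [1, 3, 4]
  | 7 => [1, 2, 5, 6]
  | 8 => [1, 2, 5, 6]
  | 9 => [1, 2, 3, 4, 7]
  | 10 => [1, 2, 3, 4, 5, 6]
  | 11 => [1, 2, 3, 4, 7, 8, 10]
  | 12 => [1, 2, 3, 4, 5, 6, 7]
  | 13 => [3, 6, 7, 8, 9, 10, 11, 12]
  | 14 => [1, 3, 4, 5, 7, 8, 9, 10, 11, 12]
  | 15 => [1, 2, 5, 6, 9, 10, 11, 12]
  | 16 => [1, 2, 3, 4, 7, 8, 10, 12]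
  | 17 => [1, 2, 3, 4, 5, 6, 8, 9, 11, 12]
  | 18 => [1, 2, 3, 4, 5, 6, 7, 11]
  | 19 => [2, 4, 5, 6, 7, 8, 9, 10, 11, 12, 13, 14, 15, 16, 17, 18]
  | 20 => [3, 6, 7, 8, 9, 10, 11, 12, 14, 15, 16, 17, 18]
  | 21 => [1, 2, 5, 6, 9, 10, 11, 12, 13, 14, 16, 17, 18]
  | 22 => [1, 2, 3, 4, 7, 8, 10, 12, 13, 14, 15, 17, 18]
  | 23 => [1, 2, 3, 4, 5, 6, 7, 11, 13, 14, 15, 16, 17]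
  | 24 => [1, 2, 3, 4, 5, 6, 7, 8, 9, 10, 13, 14, 15, 16, 17, 18]
  | _ => []

/-- The first line with the same larger end vertex as the line `t`. -/
def firstMate : ℕ → ℕ
  | 4 => 3
  | 6 => 5
  | 9 => 8
  | 10 => 8
  | 12 => 11
  | 14 => 13
  | 15 => 13
  | 16 => 13
  | 17 => 13
  | 18 => 13
  | 20 => 19
  | 21 => 19
  | 22 => 19
  | 23 => 19
  | 24 => 19
  | t => t

/-- Whether the position `k` belongs to one of the points
`(s), (s'), …, (t - 1), ((t - 1)')`, where `s = firstMate t`. -/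
def mateBefore (t k : ℕ) : Bool := decide (u (firstMate t) ≤ k) && decide (k < u t)

/-- `D_t = ∏ Z²_{ii',tt'}` over the lines `i` that do not meet `t`; the paths pass above the points
of the lines `firstMate t, …, t - 1`, and below the others. -/
def D (t : ℕ) : List B :=
  (disjointLines t).flatMap fun i => nodesAlong (mateBefore t) (dbl i) (dbl t)

/-- The complex conjugate paths: `∏ Z̄²_{ii',tt'}`, where the paths pass below the points
of the lines `firstMate t, …, t - 1`, and above the others. -/
def Dbar (t : ℕ) : List B :=
  (disjointLines t).flatMap fun i =>
    nodesAlong (fun k => !mateBefore t k) (dbl i).reverse (dbl t).reverse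

/-- The lines whose smaller end is the vertex `j`. -/
def linesFrom : ℕ → List ℕ
  | 1 => [1, 3, 19]
  | 2 => [2, 4, 5, 13, 20]
  | 3 => [6, 14]
  | 4 => [7, 8, 15, 21]
  | 5 => [9, 11, 16, 22]
  | 6 => [10, 17]
  | 7 => [12, 18, 23]
  | 8 => [24]
  | _ => []

/-- `C_j`. -/
def C (j : ℕ) : List B := (linesFrom j).flatMap D

/-- `C̄_j`, the regeneration of the parasitic braids without complex conjugation. -/
def Cbar (j : ℕ) : List B := (linesFrom j).flatMap Dbar

/-! ### The factorization -/

/-- `C₁ φ₁ · C₂ φ₂ ⋯ C₁₀ φ₁₀`. -/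
def delta48 : List B := [1, 2, 3, 4, 5, 6, 7, 8, 9, 10].flatMap fun j => C j ++ phi j

/-- `C̄₁₀ φ₁₀ · C̄₉ φ₉ ⋯ C̄₁ φ₁`. -/
def delta48bar : List B := [10, 9, 8, 7, 6, 5, 4, 3, 2, 1].flatMap fun j => Cbar j ++ phi j

end K3Braid

namespace K3Braid

/-! ### Hurwitz calculus: the subgroup of elements leaving an expression invariant. -/

section Hurwitz

variable {G : Type*} [Group G]

/-! The elements under which a factorized expression is invariant form a subgroup, `invariance`, and
an element lying in it for two blocks lies in it for their concatenation. So it is enough to treat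
the nine braids whose powers make up ρ, separately on every `C j`, `Cbar j` and `phi j`. That the
whole product is a full twist is never used.

Some invariances come directly. An element commuting with all factors is harmless, and so is
conjugating a block by an element that commutes with it. With Π the product of `l`, the expression
`l ^ h · l` is invariant under `h` as soon as `h Π h` leaves `l` invariant
(`conjList_append_mem_invariance`). Regenerated nodes and branch pairs have this form, and the
commutations they need follow from the braid relation. The three cusps of a tangency are permuted
cyclically (`cusps_mem_invariance`). This settles all parasitic blocks, two of the three lines at a
3-point, and at a 6-point the two lines `c`, `d` of the `branchPair` in `F`.

The rest comes from products. An expression is invariant under its own product Π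
(`HurwitzEquiv.conj_prod`) and under the full twist of the points it involves, which is central
among their braids. If Π times some halftwists `T` equals that full twist, these halftwists together
leave the expression invariant, and those already known can be cancelled. This gives the last line
of a 3-point and the pair of lines with a single branch point at a 6-point. For the remaining pair
`a`, `b` of a 6-point, whose halftwists define the doubling of `F`, the identity is (Π `T a T b`)²
(`T c T d`)² = full twist of eight points, with Π the product of `F` alone.

These identities are finite computations. All braids are words in the halftwists `Z a b`, the band
generators of Birman, Ko and Lee, and word reversing in these generators, evaluated by the kernel,
reduces the words to the empty one.

At a 6-point only the three products of pairs are obtained, not single halftwists. The factors of ρ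
belong to the classes of lines linked by these pairs: each class meets a given 6-point in such a
pair or not at all. -/

theorem conj_mul (x y b : G) : conj (x * y) b = conj x b * conj y b := by simp [conj, mul_assoc]

theorem conj_conj (x b c : G) : conj (conj x b) c = conj x (b * c) := by simp [conj, mul_assoc]

theorem conj_pow (x b : G) (n : ℕ) : conj (x ^ n) b = conj x b ^ n := by
  induction n with
  | zero => simp [conj]
  | succ n ih => rw [pow_succ, pow_succ, conj_mul, ih]

theorem conj_one (x : G) : conj x 1 = x := by simp [conj]

theorem conj_eq_self {x b : G} (h : Commute x b) : conj x b = x := by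
  rw [conj, mul_assoc, h.eq, inv_mul_cancel_left]

theorem conj_conj_inv (x b : G) : conj (conj x b) b⁻¹ = x := by simp [conj, mul_assoc]

theorem conj_inv_conj (x b : G) : conj (conj x b⁻¹) b = x := by simp [conj, mul_assoc]

theorem commute_conj {x y : G} (h : Commute x y) (b : G) :
    Commute (conj x b) (conj y b) := by
  rw [commute_iff_eq, ← conj_mul, ← conj_mul, h.eq]

theorem conjList_append (l m : List G) (b : G) :
    conjList (l ++ m) b = conjList l b ++ conjList m b := by simp [conjList]

theorem conjList_conjList (l : List G) (b c : G) :
    conjList (conjList l b) c = conjList l (b * c) := by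
  simp [conjList, conj_conj]

theorem conjList_one (l : List G) : conjList l 1 = l := by simp [conjList, conj_one]

theorem conjList_nil (b : G) : conjList [] b = [] := rfl

theorem conjList_cons (x : G) (l : List G) (b : G) :
    conjList (x :: l) b = conj x b :: conjList l b := rfl

theorem prod_conjList (l : List G) (b : G) : (conjList l b).prod = conj l.prod b := by
  induction l with
  | nil => simp [conjList, conj]
  | cons x l ih => rw [conjList_cons, List.prod_cons, List.prod_cons, conj_mul, ih]

theorem conjList_eq_self {l : List G} {b : G} (h : ∀ x ∈ l, Commute x b) : conjList l b = l :=
  (List.map_congr_left fun x hx => conj_eq_self (h x hx)).trans (List.map_id l)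

theorem HurwitzMove.symm {l m : List G} (h : HurwitzMove l m) : HurwitzMove m l := by
  cases h with
  | left l r a b => simpa [mul_assoc] using HurwitzMove.right l r (a * b * a⁻¹) a
  | right l r a b => simpa [mul_assoc] using HurwitzMove.left l r b (b⁻¹ * a * b)

theorem HurwitzMove.context {l m : List G} (h : HurwitzMove l m) (p q : List G) :
    HurwitzMove (p ++ l ++ q) (p ++ m ++ q) := by
  cases h with
  | left l r a b => simpa using HurwitzMove.left (p ++ l) (r ++ q) a b
  | right l r a b => simpa using HurwitzMove.right (p ++ l) (r ++ q) a b

theorem HurwitzMove.conjList {l m : List G} (h : HurwitzMove l m) (c : G) :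
    HurwitzMove (conjList l c) (conjList m c) := by
  cases h with
  | left l r a b =>
    simpa [K3Braid.conjList, conj, mul_assoc] using
      HurwitzMove.left (K3Braid.conjList l c) (K3Braid.conjList r c) (conj a c) (conj b c)
  | right l r a b =>
    simpa [K3Braid.conjList, conj, mul_assoc] using
      HurwitzMove.right (K3Braid.conjList l c) (K3Braid.conjList r c) (conj a c) (conj b c)

namespace HurwitzEquiv

theorem refl (l : List G) : HurwitzEquiv l l := Relation.ReflTransGen.refl

theorem trans {l m n : List G} (h : HurwitzEquiv l m) (h' : HurwitzEquiv m n) :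
    HurwitzEquiv l n := Relation.ReflTransGen.trans h h'

theorem symm {l m : List G} (h : HurwitzEquiv l m) : HurwitzEquiv m l := by
  induction h with
  | refl => exact .refl _
  | tail _ h ih => exact (Relation.ReflTransGen.single h.symm).trans ih

theorem of_eq {l m : List G} (h : l = m) : HurwitzEquiv l m := h ▸ refl l

theorem context {l m : List G} (h : HurwitzEquiv l m) (p q : List G) :
    HurwitzEquiv (p ++ l ++ q) (p ++ m ++ q) := by
  induction h with
  | refl => exact .refl _
  | tail _ h ih => exact Relation.ReflTransGen.tail ih (h.context p q)

theorem append {l m l' m' : List G} (h : HurwitzEquiv l m) (h' : HurwitzEquiv l' m') :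
    HurwitzEquiv (l ++ l') (m ++ m') := by
  have h1 := h.context [] l'
  have h2 := h'.context m []
  simp only [List.nil_append, List.append_nil] at h1 h2
  exact h1.trans h2

theorem conjList {l m : List G} (h : HurwitzEquiv l m) (c : G) :
    HurwitzEquiv (conjList l c) (conjList m c) := by
  induction h with
  | refl => exact .refl _
  | tail _ h ih => exact Relation.ReflTransGen.tail ih (h.conjList c)

/-- A factor moves to the right past a block, and is conjugated by its product. -/
theorem cons_swap (x : G) (l : List G) : HurwitzEquiv (x :: l) (l ++ [conj x l.prod]) := by
  induction l generalizing x with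
  | nil => exact of_eq (by simp [conj])
  | cons y l ih =>
    have h1 : HurwitzEquiv (x :: y :: l) (y :: conj x y :: l) :=
      Relation.ReflTransGen.single (by simpa [conj] using HurwitzMove.right [] l x y)
    refine h1.trans ?_
    simpa [conj_conj] using (refl [y]).append (ih (conj x y))

/-- Two neighbouring blocks can be exchanged; the first one is conjugated by the product of the
second one. -/
theorem swap (l m : List G) : HurwitzEquiv (l ++ m) (m ++ K3Braid.conjList l m.prod) := by
  induction l with
  | nil => exact of_eq (by simp [conjList_nil])
  | cons x l ih =>
    refine ((refl [x]).append ih).trans ?_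
    have := (cons_swap x m).append (refl (K3Braid.conjList l m.prod))
    simpa [conjList_cons] using this

/-- Two neighbouring blocks can be exchanged; the second one is conjugated by the inverse of the
product of the first one. -/
theorem swap' (l m : List G) :
    HurwitzEquiv (l ++ m) (K3Braid.conjList m l.prod⁻¹ ++ l) := by
  have h := (swap (K3Braid.conjList m l.prod⁻¹) l).symm
  rwa [conjList_conjList, inv_mul_cancel, conjList_one] at h

theorem swap_of_commute {l m : List G} (h : ∀ x ∈ l, ∀ y ∈ m, Commute x y) :
    HurwitzEquiv (l ++ m) (m ++ l) := by
  have := swap l m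
  rwa [conjList_eq_self] at this
  exact fun x hx => Commute.list_prod_right m x fun y hy => h x hx y hy

/-- A factorized expression is equivalent to its conjugate by its own product. -/
theorem conj_prod (l : List G) : HurwitzEquiv l (K3Braid.conjList l l.prod) := by
  induction l with
  | nil => exact refl _
  | cons x l ih =>
    -- Move `x` past `l`, then `l` past the conjugated `x`. By induction `l` may then be conjugated
    -- by its own product, and the two conjugations of `l` compose to one by `x * l.prod`.
    have h1 : HurwitzEquiv ([x] ++ l) ([conj x l.prod] ++ K3Braid.conjList l (conj x l.prod)) := by
      refine (swap [x] l).trans ((swap l _).trans (of_eq ?_))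
      simp [conjList_cons, conjList_nil]
    have h2 := ih.conjList (conj x l.prod)
    rw [conjList_conjList] at h2
    refine h1.trans (((refl _).append h2).trans (of_eq ?_))
    simp [conjList_cons, conj, mul_assoc]

end HurwitzEquiv

/-- The elements under which a factorized expression is invariant. -/
def invariance (l : List G) : Subgroup G where
  carrier := {h | IsInvariantUnder l h}
  one_mem' := HurwitzEquiv.of_eq (conjList_one l).symm
  mul_mem' {a b} ha hb := by
    have h := HurwitzEquiv.conjList ha b
    rw [conjList_conjList] at h
    exact HurwitzEquiv.trans hb h
  inv_mem' {a} ha := by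
    have h := HurwitzEquiv.conjList ha a⁻¹
    rw [conjList_conjList, mul_inv_cancel, conjList_one] at h
    exact h.symm

theorem mem_invariance {l : List G} {h : G} :
    h ∈ invariance l ↔ HurwitzEquiv l (conjList l h) := Iff.rfl

theorem prod_mem_invariance (l : List G) : l.prod ∈ invariance l := HurwitzEquiv.conj_prod l

theorem mem_invariance_of_commute {l : List G} {h : G} (H : ∀ x ∈ l, Commute x h) :
    h ∈ invariance l := HurwitzEquiv.of_eq (conjList_eq_self H).symm

theorem append_mem_invariance {l m : List G} {h : G} (hl : h ∈ invariance l)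
    (hm : h ∈ invariance m) : h ∈ invariance (l ++ m) := by
  rw [mem_invariance, conjList_append]
  exact HurwitzEquiv.append hl hm

theorem flatMap_mem_invariance {ι : Type*} {s : List ι} {f : ι → List G} {h : G}
    (H : ∀ i ∈ s, h ∈ invariance (f i)) : h ∈ invariance (s.flatMap f) := by
  induction s with
  | nil => exact HurwitzEquiv.refl _
  | cons i s ih =>
    rw [List.flatMap_cons]
    exact append_mem_invariance (H i (by simp)) (ih fun j hj => H j (by simp [hj]))

theorem conj_mem_invariance_conjList {l : List G} {h : G} (hl : h ∈ invariance l) (c : G) :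
    conj h c ∈ invariance (conjList l c) := by
  have := HurwitzEquiv.conjList (mem_invariance.1 hl) c
  rw [conjList_conjList] at this
  rw [mem_invariance, conjList_conjList]
  simpa [conj, mul_assoc] using this

/-- This removes the exponents of the local braid monodromies: a block and its conjugate by `c` have
the same invariance under elements commuting with `c`. -/
theorem conjList_mem_invariance {l : List G} {h c : G} (hl : h ∈ invariance l)
    (hc : Commute c h) : h ∈ invariance (conjList l c) := by
  have := conj_mem_invariance_conjList hl c
  rwa [conj_eq_self hc.symm] at this

theorem invariance_congr {l m : List G} (e : HurwitzEquiv l m) : invariance l = invariance m := by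
  ext h
  exact ⟨fun H => e.symm.trans (H.trans (e.conjList h)),
    fun H => e.trans (H.trans (e.symm.conjList h))⟩

/-- The criterion for the invariance of a doubled expression. -/
theorem conjList_append_mem_invariance {l : List G} {h : G}
    (H : h * l.prod * h ∈ invariance l) : h ∈ invariance (conjList l h ++ l) := by
  rw [mem_invariance, conjList_append, conjList_conjList]
  -- Moving `l` to the front conjugates it by the inverse of Π^h, with Π the product of `l`. The
  -- front block of the target is `l` conjugated by `h²`, and the two differ by `h² · Π^h = h Π h`.
  refine (HurwitzEquiv.swap' _ _).trans (HurwitzEquiv.append ?_ (.refl _))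
  have h1 : HurwitzEquiv l (conjList l (h * l.prod * h)⁻¹) := inv_mem H
  have h2 := (h1.conjList (h * h)).symm
  rw [conjList_conjList] at h2
  rw [prod_conjList]
  refine .trans (.of_eq ?_) h2
  congr 1
  simp [conj, mul_assoc]

/-! ### Pairs of elements satisfying the braid relation -/

/-- The braid relation. -/
def Braided (a b : G) : Prop := a * b * a = b * a * b

theorem Braided.symm {a b : G} (h : Braided a b) : Braided b a := Eq.symm h

theorem Braided.conj {a b : G} (h : Braided a b) (c : G) :
    Braided (conj a c) (conj b c) := by
  simp only [Braided, ← conj_mul]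
  exact congrArg (K3Braid.conj · c) h

theorem Braided.of_conj {a b c : G} (h : Braided (K3Braid.conj a c) (K3Braid.conj b c)) :
    Braided a b := by
  simpa [conj_conj_inv] using h.conj c⁻¹

/-- The braid relation trades a conjugate of `a` for a conjugate of `b`. -/
theorem Braided.conj_left {a b : G} (h : Braided a b) :
    K3Braid.conj a b = K3Braid.conj b a⁻¹ := by
  simp only [K3Braid.conj, inv_inv]
  rw [mul_assoc, inv_mul_eq_iff_eq_mul, ← mul_assoc, ← mul_assoc, eq_mul_inv_iff_mul_eq]
  exact h

/-- Both sides become conjugates by `z⁻¹`, of the commuting `t` and `r`. -/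
theorem Braided.commute_conj {z t r : G} (hzt : Braided z t) (hzr : Braided z r)
    (h : Commute t r) : Commute (K3Braid.conj z t) (K3Braid.conj z r) := by
  rw [hzt.conj_left, hzr.conj_left]
  exact K3Braid.commute_conj h _

/-- In the braid group on three strands `z * (t * z ^ 2 * t) * z` is the full twist, hence central.
-/
theorem Braided.commute_mul {z t : G} (h : Braided z t) : Commute z (t * z ^ 2 * t) :=
  calc z * (t * z ^ 2 * t) = (z * t * z) * z * t := by simp only [pow_two, mul_assoc]
    _ = t * z * (t * z * t) := by rw [h]; simp only [mul_assoc]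
    _ = t * z ^ 2 * t * z := by rw [← h]; simp only [pow_two, mul_assoc]

/-- This is what closes the cyclic permutation of three cusps; it reduces to the commutation of `z`
with `t * z ^ 2 * t`. -/
theorem Braided.commute_mul_mul {z t : G} (h : Braided z t) :
    Commute z (t * z ^ 3 * t * z ^ 3 * t) := by
  have h2 := (h.commute_mul.pow_left 2).eq
  calc z * (t * z ^ 3 * t * z ^ 3 * t)
      = (z * t * z) * z ^ 2 * t * z ^ 3 * t := by simp only [pow_succ, pow_zero, one_mul, mul_assoc]
    _ = t * z * (t * z ^ 2 * t * z ^ 2) * z * t := by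
      rw [h]; simp only [pow_succ, pow_zero, one_mul, mul_assoc]
    _ = t * z ^ 3 * t * z ^ 2 * (t * z * t) := by
      rw [← h2]; simp only [pow_succ, pow_zero, one_mul, mul_assoc]
    _ = t * z ^ 3 * t * z ^ 3 * t * z := by
      rw [← h]; simp only [pow_succ, pow_zero, one_mul, mul_assoc]

/-- For `t`, `z`, `r` = σ₁, σ₂, σ₃ the product `t * r * z * (t * r) * z` is the half twist of four
strands, which commutes with the middle generator. -/
theorem Braided.commute_mul_of_commute {z t r : G} (hzt : Braided z t) (hzr : Braided z r)
    (h : Commute t r) : Commute z (t * r * z * (t * r)) :=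
  calc z * (t * r * z * (t * r)) = z * r * t * z * t * r := by
        rw [mul_assoc z r t, ← h.eq]; simp only [mul_assoc]
    _ = z * r * (t * z * t) * r := by simp only [mul_assoc]
    _ = (z * r * z) * t * z * r := by rw [← hzt]; simp only [mul_assoc]
    _ = r * (z * (r * t) * z * r) := by rw [hzr]; simp only [mul_assoc]
    _ = r * (z * t * (r * z * r)) := by rw [← h.eq]; simp only [mul_assoc]
    _ = r * ((z * t * z) * (r * z)) := by rw [← hzr]; simp only [mul_assoc]
    _ = (r * t) * z * (t * r) * z := by rw [hzt]; simp only [mul_assoc]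
    _ = t * r * z * (t * r) * z := by rw [h.eq]

/-- The invariance of a regenerated node, or of a doubled pair of branch points. -/
theorem Braided.pair_mem_invariance {z t : G} (h : Braided z t) {l : List G}
    (hl : ∀ x ∈ l, ∃ n : ℕ, x = z ^ n) (hp : l.prod = z ^ 2) :
    t ∈ invariance (conjList l t ++ l) := by
  refine conjList_append_mem_invariance (mem_invariance_of_commute fun x hx => ?_)
  obtain ⟨n, rfl⟩ := hl x hx
  rw [hp]
  exact h.commute_mul.pow_left n

/-- The invariance of a regenerated node of two doubled lines. -/
theorem Braided.quadruple_mem_invariance {z t r : G} (hzt : Braided z t) (hzr : Braided z r)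
    (h : Commute t r) {l : List G} (hl : ∀ x ∈ l, ∃ n : ℕ, x = z ^ n) (hp : l.prod = z ^ 2) :
    t ∈ invariance (conjList l (t * r) ++ conjList l t ++ (conjList l r ++ l)) ∧
      r ∈ invariance (conjList l (t * r) ++ conjList l t ++ (conjList l r ++ l)) := by
  -- As given, the expression is a doubled pair for `r` followed by itself, conjugated by `t` in the
  -- first copy. Exchanging the two middle blocks, which commute, interchanges the roles of `t` and
  -- `r`.
  have e : HurwitzEquiv (conjList l (t * r) ++ conjList l t ++ (conjList l r ++ l))
      (conjList (conjList l t ++ l) r ++ (conjList l t ++ l)) := by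
    simp only [conjList_append, conjList_conjList, List.append_assoc]
    refine (HurwitzEquiv.refl _).append ?_
    simp only [← List.append_assoc]
    refine .append (HurwitzEquiv.swap_of_commute ?_) (.refl _)
    simp only [conjList, List.mem_map]
    rintro _ ⟨x, hx, rfl⟩ _ ⟨y, hy, rfl⟩
    obtain ⟨m, rfl⟩ := hl x hx
    obtain ⟨n, rfl⟩ := hl y hy
    rw [conj_pow, conj_pow]
    exact (hzt.commute_conj hzr h).pow_pow m n
  constructor
  · rw [invariance_congr e]
    have := hzt.pair_mem_invariance hl hp
    exact append_mem_invariance (conjList_mem_invariance this h.symm) this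
  · have := hzr.pair_mem_invariance hl hp
    refine append_mem_invariance ?_ this
    have h' := conjList_mem_invariance this h
    rwa [conjList_append, conjList_conjList, ← h.eq] at h'

/-- The invariance of a regenerated branch point. -/
theorem Braided.branch_mem_invariance {z t r : G} (hzt : Braided z t) (hzr : Braided z r)
    (h : Commute t r) : t * r ∈ invariance [K3Braid.conj z (t * r), z] := by
  refine conjList_append_mem_invariance (l := [z]) (mem_invariance_of_commute ?_)
  simpa using hzt.commute_mul_of_commute hzr h

/-- The invariance of the three cusps to which a tangency regenerates. -/
theorem cusps_mem_invariance {z t : B} (h : Braided z t) :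
    t ∈ invariance (cusps z t) := by
  -- When the third cusp moves to the front it becomes the conjugate of `z ^ 3` by `t²`. The list is
  -- then the original one conjugated by `t`.
  have e : conj (conj (z ^ 3) t⁻¹) [conj (z ^ 3) t, z ^ 3].prod⁻¹ = conj (z ^ 3) (t * t) := by
    have c := (h.commute_mul_mul.pow_left 3)
    have := congrArg (K3Braid.conj · (t * t)) (conj_eq_self c.inv_right)
    simp only [conj_conj] at this
    rw [← this, conj_conj]
    congr 1
    simp [conj, mul_assoc]
  have := HurwitzEquiv.swap' [K3Braid.conj (z ^ 3) t, z ^ 3] [K3Braid.conj (z ^ 3) t⁻¹]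
  rw [conjList_cons, e] at this
  refine this.trans (.of_eq ?_)
  simp [cusps, conjList, conj_conj, conj_one]

/-- The invariance of a doubled expression, when the square of `f * h` with `f` the product
of the factors acts as an element of the invariance group. -/
theorem append_conjList_inv_mem_invariance {l : List G} {h : G}
    (H : l.prod * h * l.prod * h ∈ invariance l) :
    h ∈ invariance (l ++ conjList l h⁻¹) := by
  -- The doubling criterion is applied to `l` conjugated by `h⁻¹`. After conjugating back it asks
  -- for `h * l.prod * h`, and a factor `l.prod` is free.
  have e : conjList (conjList l h⁻¹) h ++ conjList l h⁻¹ = l ++ conjList l h⁻¹ := by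
    rw [conjList_conjList, inv_mul_cancel, conjList_one]
  rw [← e]
  refine conjList_append_mem_invariance ?_
  have h1 := mul_mem (inv_mem (prod_mem_invariance l)) H
  have h2 := conj_mem_invariance_conjList h1 h⁻¹
  convert h2 using 1
  rw [prod_conjList]
  simp [conj, mul_assoc]

end Hurwitz
/-! ### Halftwists along paths -/

theorem commute_σ {i j : ℕ} (hi : 1 ≤ i) (h : i + 2 ≤ j) : Commute (σ i) (σ j) := by
  unfold σ
  split_ifs with h1 h2
  · rw [commute_iff_eq, ← mul_inv_eq_one]
    exact PresentedGroup.one_of_mem (rels := braidRels 48)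
      (Or.inl ⟨⟨i - 1, h1⟩, ⟨j - 1, h2⟩, by simp; omega, rfl⟩)
  · exact Commute.one_right _
  · exact Commute.one_left _
  · exact Commute.one_left _

theorem braided_σ {i : ℕ} (hi : 1 ≤ i) (h : i < 47) : Braided (σ i) (σ (i + 1)) := by
  unfold σ
  rw [dif_pos (by omega), dif_pos (by omega), Braided, ← mul_inv_eq_one]
  exact PresentedGroup.one_of_mem (rels := braidRels 48)
    (Or.inr ⟨⟨i - 1, by omega⟩, ⟨i, by omega⟩, by simp; omega, rfl⟩)

/-- The letter by which the right end of a path moves over one place. -/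
def slide (above : ℕ → Bool) (k : ℕ) : B := bif above k then (σ k)⁻¹ else σ k

theorem halfTwist_succ_self (above : ℕ → Bool) (a : ℕ) : halfTwist above a (a + 1) = σ a := by
  simp [halfTwist, conj]

theorem halfTwist_succ (above : ℕ → Bool) {a b : ℕ} (h : a < b) :
    halfTwist above a (b + 1) = conj (halfTwist above a b) (slide above b) := by
  rw [halfTwist, List.Ico.succ_top (by omega), List.map_append, List.prod_append, halfTwist,
    conj_conj]
  simp [slide]

theorem commute_slide {above : ℕ → Bool} {k : ℕ} {x : B} (h : Commute x (σ k)) :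
    Commute x (slide above k) := by
  unfold slide
  cases above k
  · exact h
  · exact h.inv_right

theorem Braided.conj_slide_left {above : ℕ → Bool} {x : B} {k : ℕ} (h : Braided x (σ k)) :
    K3Braid.conj x (slide above k) = K3Braid.conj (σ k) (bif above k then x else x⁻¹) := by
  unfold slide
  cases above k
  · exact Braided.conj_left h
  · have := Braided.conj_left h.symm
    simp only [cond_true]
    exact this.symm

theorem commute_halfTwist {above : ℕ → Bool} {x : B} {a b : ℕ} (hab : a < b)
    (h : ∀ k, a ≤ k → k < b → Commute x (σ k)) : Commute x (halfTwist above a b) := by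
  induction b, hab using Nat.le_induction with
  | base => rw [halfTwist_succ_self]; exact h a le_rfl (by omega)
  | succ b hb ih =>
    rw [halfTwist_succ above hb]
    have h1 := commute_slide (above := above) (h b (by omega) (by omega))
    have h2 := commute_conj (ih fun k hk hk' => h k hk (by omega)) (slide above b)
    rwa [conj_eq_self h1] at h2

theorem commute_halfTwist_σ_outside {above : ℕ → Bool} {a b k : ℕ} (ha : 1 ≤ a) (hab : a < b)
    (hk : 1 ≤ k) (h : b < k ∨ k + 1 < a) : Commute (halfTwist above a b) (σ k) := by
  refine (commute_halfTwist hab fun j hj hj' => ?_).symm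
  rcases h with h | h
  · exact (commute_σ (by omega) (by omega)).symm
  · exact commute_σ hk (by omega)

/-- Extending the path by one point turns the pair into a conjugate of the previous one, since `σ (b
+ 1)` commutes with the shorter halftwist. -/
theorem braided_halfTwist_σ {above : ℕ → Bool} {a b : ℕ} (ha : 1 ≤ a) (hab : a < b)
    (hb : b < 48) : Braided (halfTwist above a b) (σ b) := by
  induction b, hab using Nat.le_induction with
  | base => rw [halfTwist_succ_self]; exact braided_σ ha (by omega)
  | succ b hab ih =>
    replace hab : a < b := hab
    have h1 := ih (by omega)
    have h2 : Commute (halfTwist above a b) (σ (b + 1)) :=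
      commute_halfTwist_σ_outside ha hab (by omega) (by omega)
    have h3 := braided_σ (i := b) (by omega) (by omega)
    rw [halfTwist_succ above hab]
    refine Braided.of_conj (c := (slide above b)⁻¹) ?_
    rw [conj_conj_inv]
    have e : conj (σ (b + 1)) (slide above b)⁻¹ =
        conj (σ b) (bif above b then (σ (b + 1))⁻¹ else σ (b + 1)) := by
      unfold slide
      cases above b
      · exact (Braided.conj_left h3).symm
      · simpa using Braided.conj_left h3.symm
    rw [e]
    have h4 := h1.conj (bif above b then (σ (b + 1))⁻¹ else σ (b + 1))
    rw [conj_eq_self] at h4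
    · exact h4
    · cases above b
      · exact h2
      · exact h2.inv_right

/-- The left end slides like the right one. Moves at the two ends commute once a point lies between
them, so only the shortest case needs the braid relation. -/
theorem halfTwist_left {above : ℕ → Bool} {a b : ℕ} (ha : 1 ≤ a) (hab : a + 1 < b) (hb : b ≤ 48) :
    halfTwist above (a + 1) b =
      conj (halfTwist above a b) (bif above (a + 1) then (σ a)⁻¹ else σ a) := by
  induction b, hab using Nat.le_induction with
  | base =>
    rw [halfTwist_succ above (by omega : a < a + 1), halfTwist_succ_self, halfTwist_succ_self,
      (braided_σ ha (by omega)).conj_slide_left]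
    cases above (a + 1) <;> simp [conj_conj, conj_one]
  | succ b hab ih =>
    replace hab : a + 1 < b := hab
    rw [halfTwist_succ above hab, halfTwist_succ above (by omega : a < b), ih (by omega),
      conj_conj, conj_conj]
    congr 1
    have h : Commute (σ a) (slide above b) := commute_slide (commute_σ ha (by omega))
    cases above (a + 1)
    · exact h
    · exact h.inv_left

theorem braided_halfTwist_σ_left {above : ℕ → Bool} {a b : ℕ} (ha : 1 ≤ a) (hab : a + 1 < b)
    (hb : b ≤ 48) : Braided (halfTwist above a b) (σ a) := by
  have key : Braided (halfTwist above (a + 1) b) (σ a) := by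
    induction b, hab using Nat.le_induction with
    | base => rw [halfTwist_succ_self]; exact (braided_σ ha (by omega)).symm
    | succ b hab ih =>
      replace hab : a + 1 < b := hab
      rw [halfTwist_succ above hab]
      have h := (ih (by omega)).conj (slide above b)
      rwa [conj_eq_self (commute_slide (commute_σ ha (by omega)))] at h
  rw [halfTwist_left ha hab hb] at key
  refine Braided.of_conj (c := bif above (a + 1) then (σ a)⁻¹ else σ a) ?_
  rwa [conj_eq_self (x := σ a)]
  cases above (a + 1)
  · exact Commute.refl _
  · exact (Commute.refl _).inv_right

/-- The path passes both points on the same side and so misses the segment between them.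
Algebraically, sliding the right end over both carries `σ (k + 1)`, which commutes with the shorter
halftwist, to `σ k`. -/
theorem commute_halfTwist_σ_between {above : ℕ → Bool} {a b k : ℕ} (ha : 1 ≤ a) (hk : a < k)
    (hkb : k + 1 < b) (hb : b ≤ 48) (h : above k = above (k + 1)) :
    Commute (halfTwist above a b) (σ k) := by
  induction b, hkb using Nat.le_induction with
  | base =>
    rw [halfTwist_succ above (by omega : a < k + 1), halfTwist_succ above hk, conj_conj]
    have h1 : Commute (halfTwist above a k) (σ (k + 1)) :=
      commute_halfTwist_σ_outside ha hk (by omega) (by omega)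
    have h2 := commute_conj h1 (slide above k * slide above (k + 1))
    have e : conj (σ (k + 1)) (slide above k * slide above (k + 1)) = σ k := by
      have h3 := braided_σ (i := k) (by omega) (by omega)
      unfold slide
      rw [← h, ← conj_conj]
      cases above k
      · have := Braided.conj_left h3.symm
        simp only [cond_false]
        rw [this, conj_inv_conj]
      · have := Braided.conj_left h3
        simp only [cond_true]
        rw [← this, conj_conj_inv]
    rwa [e] at h2
  | succ b hb' ih =>
    rw [halfTwist_succ above (by omega : a < b)]
    have h1 := commute_conj (ih (by omega)) (slide above b)
    rwa [conj_eq_self (commute_slide (commute_σ (by omega) (by omega)))] at h1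

/-! ### The relations between the halftwists along the paths below the real axis -/

theorem Z_conj_Z {a b c : ℕ} (ha : 1 ≤ a) (hab : a < b) (hbc : b < c) :
    conj (Z a b) (Z b c) = Z a c := by
  unfold Z
  induction c, hbc using Nat.le_induction with
  | base => rw [halfTwist_succ_self, halfTwist_succ _ hab]; rfl
  | succ c hbc ih =>
    rw [halfTwist_succ _ hbc, halfTwist_succ _ (by omega : a < c), ← ih]
    have h : Commute (halfTwist (fun _ => false) a b) (σ c) :=
      commute_halfTwist_σ_outside ha hab (by omega) (by omega)
    nth_rewrite 1 [← conj_eq_self (commute_slide (above := fun _ => false) h)]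
    rw [conj_conj, conj_conj]
    congr 1
    simp [conj, mul_assoc]

theorem braided_Z {a b c : ℕ} (ha : 1 ≤ a) (hab : a < b) (hbc : b < c) (hc : c ≤ 48) :
    Braided (Z a b) (Z b c) := by
  unfold Z
  induction c, hbc using Nat.le_induction with
  | base => rw [halfTwist_succ_self]; exact braided_halfTwist_σ ha hab (by omega)
  | succ c hbc ih =>
    have h := (ih (by omega)).conj (slide (fun _ => false) c)
    rwa [conj_eq_self (commute_slide (commute_halfTwist_σ_outside ha hab (by omega) (by omega))),
      ← halfTwist_succ _ hbc] at h

theorem commute_Z_of_lt {a b c d : ℕ} (ha : 1 ≤ a) (hab : a < b) (hbc : b < c) (hcd : c < d) :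
    Commute (Z a b) (Z c d) :=
  commute_halfTwist hcd fun k hk _ =>
    commute_halfTwist_σ_outside ha hab (by omega) (by omega)

theorem commute_Z_of_nested {a b c d : ℕ} (ha : 1 ≤ a) (hab : a < b) (hbc : b < c) (hcd : c < d)
    (hd : d ≤ 48) : Commute (Z a d) (Z b c) :=
  commute_halfTwist hbc fun k hk _ =>
    commute_halfTwist_σ_between ha (by omega) (by omega) hd rfl

/-- Together with `Z_mul_Z'`, the triangle relations `Z a b * Z b c = Z b c * Z a c = Z a c * Z a
b`. With the commutation of disjoint and of nested pairs they are the Birman–Ko–Lee relations. -/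
theorem Z_mul_Z {a b c : ℕ} (ha : 1 ≤ a) (hab : a < b) (hbc : b < c) :
    Z a b * Z b c = Z b c * Z a c := by
  rw [← Z_conj_Z ha hab hbc, conj]; group

theorem Z_mul_Z' {a b c : ℕ} (ha : 1 ≤ a) (hab : a < b) (hbc : b < c) (hc : c ≤ 48) :
    Z a b * Z b c = Z a c * Z a b := by
  have h := braided_Z ha hab hbc hc
  rw [← Z_conj_Z ha hab hbc, conj, mul_assoc, mul_assoc, ← mul_assoc (Z a b), h, ← mul_assoc,
    ← mul_assoc]
  simp

/-! ### The word problem in the halftwists `Z a b`, by word reversing -/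

/-- The word `c` for which `Z x * c` is the least common right multiple of `Z x` and `Z y`. -/
def complement (x y : ℕ × ℕ) : List (ℕ × ℕ) :=
  bif x.1.beq y.1 then
    bif x.2.beq y.2 then []
    else bif x.2.ble y.2 then [(x.2, y.2)] else [(x.1, y.2)]
  else bif x.2.beq y.2 then
    bif x.1.ble y.1 then [(x.1, y.1)] else [(y.1, x.2)]
  else bif x.2.beq y.1 then [(x.2, y.2)]
  else bif x.1.beq y.2 then [(y.1, x.2)]
  else bif x.1.ble y.1 && (y.1.ble x.2 && x.2.ble y.2) then [(x.1, y.1), (x.2, y.2)]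
  else bif y.1.ble x.1 && (x.1.ble y.2 && y.2.ble x.2) then [(y.1, x.2), (x.1, y.2)]
  else [y]

/-- Writes `xs⁻¹ * ys`, for positive words, as `ys' * xs'⁻¹`; the first argument bounds the depth of
the recursion. -/
def reversing : ℕ → List (ℕ × ℕ) → List (ℕ × ℕ) → Option (List (ℕ × ℕ) × List (ℕ × ℕ))
  | 0, _, _ => none
  | _ + 1, [], ys => some (ys, [])
  | _ + 1, x :: xs, [] => some ([], x :: xs)
  | n + 1, x :: xs, y :: ys =>
    match reversing n xs (complement x y), reversing n (complement y x) ys with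
    | some (c, xs₁), some (ys₁, d) =>
      match reversing n xs₁ ys₁ with
      | some (ys₂, xs₂) => some (c ++ ys₂, d ++ xs₂)
      | none => none
    | _, _ => none

/-- Writes `xs⁻¹ * w`, for a positive word `xs` and a word `w` with signs, as `ys * xs'⁻¹` with
positive words. -/
def fraction (n : ℕ) : List (Bool × ℕ × ℕ) → List (ℕ × ℕ) →
    Option (List (ℕ × ℕ) × List (ℕ × ℕ))
  | [], xs => some ([], xs)
  | (false, x) :: w, xs => fraction n w (x :: xs)
  | (true, x) :: w, xs =>
    match reversing n xs [x] with
    | some (ys, xs₁) =>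
      match fraction n w xs₁ with
      | some (ys₂, xs₂) => some (ys ++ ys₂, xs₂)
      | none => none
    | none => none

/-- Whether `Z x` is a halftwist of two of the `48` points. -/
def IsLetter (x : ℕ × ℕ) : Prop := 1 ≤ x.1 ∧ x.1 < x.2 ∧ x.2 ≤ 48

instance (x : ℕ × ℕ) : Decidable (IsLetter x) := inferInstanceAs (Decidable (_ ∧ _ ∧ _))

/-- Whether the word `w` reduces to the empty word. -/
def isTrivial (w : List (Bool × ℕ × ℕ)) : Bool :=
  w.all (fun x => decide (IsLetter x.2)) &&
    match fraction 1000 w [] with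
    | some (ys, xs) =>
      match reversing 1000 xs ys with
      | some ([], []) => true
      | _ => false
    | none => false

/-- The braid of a positive word. -/
def pos (w : List (ℕ × ℕ)) : B := (w.map fun x => Z x.1 x.2).prod

/-- The braid of a letter with a sign. -/
def evalLetter (x : Bool × ℕ × ℕ) : B := bif x.1 then Z x.2.1 x.2.2 else (Z x.2.1 x.2.2)⁻¹

/-- The braid of a word with signs. -/
def eval (w : List (Bool × ℕ × ℕ)) : B := (w.map evalLetter).prod

theorem pos_nil : pos [] = 1 := rfl

theorem pos_cons (x : ℕ × ℕ) (w : List (ℕ × ℕ)) : pos (x :: w) = Z x.1 x.2 * pos w := by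
  simp [pos]

theorem pos_append (v w : List (ℕ × ℕ)) : pos (v ++ w) = pos v * pos w := by simp [pos]

/-- Only a common right multiple is needed for soundness; that it is the least one matters for the
success of the reversing, not for its correctness. -/
theorem complement_spec {x y : ℕ × ℕ} (hx : IsLetter x) (hy : IsLetter y) :
    (∀ a ∈ complement x y, IsLetter a) ∧
      Z x.1 x.2 * pos (complement x y) = Z y.1 y.2 * pos (complement y x) := by
  obtain ⟨a, b⟩ := x
  obtain ⟨c, d⟩ := y
  have e : ∀ m n : ℕ, m.beq n = decide (m = n) := fun m n => by
    rw [Bool.eq_iff_iff]; simp [Nat.beq_eq]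
  have e' : ∀ m n : ℕ, m.ble n = decide (m ≤ n) := fun m n => by
    rw [Bool.eq_iff_iff]; simp
  have r₁ : ∀ {p q r : ℕ}, 1 ≤ p → p < q → q < r → r ≤ 48 → Z p q * Z q r = Z q r * Z p r :=
    fun h₁ h₂ h₃ _ => Z_mul_Z h₁ h₂ h₃
  have r₂ : ∀ {p q r : ℕ}, 1 ≤ p → p < q → q < r → r ≤ 48 → Z p q * Z q r = Z p r * Z p q :=
    Z_mul_Z'
  have r₃ : ∀ {p q r s : ℕ}, 1 ≤ p → p < q → q < r → r < s → s ≤ 48 →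
      Z p q * Z r s = Z r s * Z p q := fun h₁ h₂ h₃ h₄ _ => commute_Z_of_lt h₁ h₂ h₃ h₄
  have r₄ : ∀ {p q r s : ℕ}, 1 ≤ p → p < q → q < r → r < s → s ≤ 48 →
      Z p s * Z q r = Z q r * Z p s := fun h₁ h₂ h₃ h₄ h₅ => commute_Z_of_nested h₁ h₂ h₃ h₄ h₅
  simp only [IsLetter] at hx hy
  simp only [complement, e, e', Bool.cond_eq_ite, Bool.and_eq_true, decide_eq_true_eq, pos]
  generalize Z = z at r₁ r₂ r₃ r₄ ⊢
  -- Two crossing chords `(p, r)` and `(q, s)`: both sides are factorizations of the rotation of the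
  -- four points `p < q < r < s`.
  have r₅ : ∀ {p q r s : ℕ}, 1 ≤ p → p < q → q < r → r < s → s ≤ 48 →
      z p r * (z p q * z r s) = z q s * (z p s * z q r) := fun h₁ h₂ h₃ h₄ h₅ => by
    rw [← mul_assoc, ← mul_assoc, ← r₂ h₁ h₂ h₃ (by omega), ← r₁ h₁ h₂ (by omega) h₅,
      mul_assoc, mul_assoc, r₂ (by omega) h₃ h₄ h₅]
  constructor
  · split_ifs <;> simp [IsLetter] <;> omega
  · split_ifs <;> first
      | omega
      | (subst_vars
         simp only [List.map_cons, List.map_nil, List.prod_cons, List.prod_nil, mul_one]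
         try first
          | exact r₂ (by omega) (by omega) (by omega) (by omega)
          | exact (r₂ (by omega) (by omega) (by omega) (by omega)).symm
          | exact r₁ (by omega) (by omega) (by omega) (by omega)
          | exact (r₁ (by omega) (by omega) (by omega) (by omega)).symm
          | exact (r₂ (by omega) (by omega) (by omega) (by omega)).symm.trans
              (r₁ (by omega) (by omega) (by omega) (by omega))
          | exact (r₁ (by omega) (by omega) (by omega) (by omega)).symm.trans
              (r₂ (by omega) (by omega) (by omega) (by omega))
          | exact r₅ (by omega) (by omega) (by omega) (by omega) (by omega)
          | exact (r₅ (by omega) (by omega) (by omega) (by omega) (by omega)).symm)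
    -- The chords left over share no end and do not cross: they are disjoint or nested, and the
    -- letters commute.
    have h : b < c ∨ d < a ∨ (a < c ∧ d < b) ∨ (c < a ∧ b < d) := by omega
    rcases h with h | h | h | h
    · exact r₃ hx.1 hx.2.1 h hy.2.1 hy.2.2
    · exact (r₃ hy.1 hy.2.1 h hx.2.1 hx.2.2).symm
    · exact r₄ hx.1 h.1 hy.2.1 h.2 hx.2.2
    · exact (r₄ hy.1 h.1 hx.2.1 h.2 hy.2.2).symm

theorem reversing_spec {n : ℕ} {xs ys xs' ys' : List (ℕ × ℕ)} (hx : ∀ a ∈ xs, IsLetter a)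
    (hy : ∀ a ∈ ys, IsLetter a) (h : reversing n xs ys = some (ys', xs')) :
    (∀ a ∈ xs', IsLetter a) ∧ (∀ a ∈ ys', IsLetter a) ∧ pos xs * pos ys' = pos ys * pos xs' := by
  induction n generalizing xs ys xs' ys' with
  | zero => simp [reversing] at h
  | succ n ih =>
    match xs, ys with
    | [], ys =>
      simp only [reversing, Option.some.injEq, Prod.mk.injEq] at h
      obtain ⟨rfl, rfl⟩ := h
      exact ⟨hx, hy, by simp [pos_nil]⟩
    | x :: xs, [] =>
      simp only [reversing, Option.some.injEq, Prod.mk.injEq] at h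
      obtain ⟨rfl, rfl⟩ := h
      exact ⟨hx, hy, by simp [pos_nil]⟩
    | x :: xs, y :: ys =>
      simp only [List.mem_cons, forall_eq_or_imp] at hx hy
      rw [reversing] at h
      split at h
      · rename_i c xs₁ ys₁ d h1 h2
        split at h
        · rename_i ys₂ xs₂ h3
          simp only [Option.some.injEq, Prod.mk.injEq] at h
          obtain ⟨rfl, rfl⟩ := h
          obtain ⟨hc, e⟩ := complement_spec hx.1 hy.1
          obtain ⟨a1, a2, a3⟩ := ih hx.2 hc h1
          obtain ⟨b1, b2, b3⟩ := ih (complement_spec hy.1 hx.1).1 hy.2 h2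
          obtain ⟨c1, c2, c3⟩ := ih a1 b2 h3
          refine ⟨?_, ?_, ?_⟩
          · simp only [List.mem_append]
            rintro a (h | h)
            exacts [b1 a h, c1 a h]
          · simp only [List.mem_append]
            rintro a (h | h)
            exacts [a2 a h, c2 a h]
          · rw [pos_cons, pos_cons, pos_append, pos_append]
            calc Z x.1 x.2 * pos xs * (pos c * pos ys₂)
                = Z x.1 x.2 * (pos xs * pos c) * pos ys₂ := by simp only [mul_assoc]
              _ = Z x.1 x.2 * pos (complement x y) * (pos xs₁ * pos ys₂) := by
                rw [a3]; simp only [mul_assoc]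
              _ = Z y.1 y.2 * (pos (complement y x) * pos ys₁) * pos xs₂ := by
                rw [c3, e]; simp only [mul_assoc]
              _ = Z y.1 y.2 * pos ys * (pos d * pos xs₂) := by
                rw [b3]; simp only [mul_assoc]
        · simp at h
      · simp at h

theorem eval_cons (x : Bool × ℕ × ℕ) (w : List (Bool × ℕ × ℕ)) :
    eval (x :: w) = evalLetter x * eval w := by simp [eval]

theorem fraction_spec {n : ℕ} {w : List (Bool × ℕ × ℕ)} {xs xs' ys : List (ℕ × ℕ)}
    (hw : ∀ a ∈ w, IsLetter a.2) (hx : ∀ a ∈ xs, IsLetter a)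
    (h : fraction n w xs = some (ys, xs')) :
    (∀ a ∈ xs', IsLetter a) ∧ (∀ a ∈ ys, IsLetter a) ∧ pos xs * pos ys = eval w * pos xs' := by
  induction w generalizing xs xs' ys with
  | nil =>
    simp only [fraction, Option.some.injEq, Prod.mk.injEq] at h
    obtain ⟨rfl, rfl⟩ := h
    exact ⟨hx, by simp, by simp [pos_nil, eval]⟩
  | cons x w ih =>
    simp only [List.mem_cons, forall_eq_or_imp] at hw
    obtain ⟨s, x⟩ := x
    cases s with
    | false =>
      rw [fraction] at h
      have hx' : ∀ a ∈ x :: xs, IsLetter a := by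
        simp only [List.mem_cons, forall_eq_or_imp]
        exact ⟨hw.1, hx⟩
      obtain ⟨a1, a2, a3⟩ := ih hw.2 hx' h
      refine ⟨a1, a2, ?_⟩
      rw [pos_cons, mul_assoc] at a3
      rw [eval_cons, mul_assoc, ← a3]
      simp [evalLetter]
    | true =>
      rw [fraction] at h
      split at h
      · rename_i ys₁ xs₁ h1
        split at h
        · rename_i ys₂ xs₂ h2
          simp only [Option.some.injEq, Prod.mk.injEq] at h
          obtain ⟨rfl, rfl⟩ := h
          obtain ⟨a1, a2, a3⟩ := reversing_spec hx (by simpa using hw.1) h1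
          obtain ⟨b1, b2, b3⟩ := ih hw.2 a1 h2
          refine ⟨b1, ?_, ?_⟩
          · simp only [List.mem_append]
            rintro a (h | h)
            exacts [a2 a h, b2 a h]
          · rw [pos_append, ← mul_assoc, a3, mul_assoc, b3, eval_cons]
            simp [pos_cons, pos_nil, evalLetter, mul_assoc]
        · simp at h
      · simp at h

/-- `w` is rewritten as a fraction of positive words, and numerator and denominator then reverse
against each other to nothing, so they are equal braids. -/
theorem eval_eq_one {w : List (Bool × ℕ × ℕ)} (h : isTrivial w = true) : eval w = 1 := by
  rw [isTrivial, Bool.and_eq_true, List.all_eq_true] at h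
  obtain ⟨hw, h⟩ := h
  split at h
  · rename_i ys xs h1
    obtain ⟨a1, a2, a3⟩ := fraction_spec (fun a ha => of_decide_eq_true (hw a ha)) (by simp) h1
    split at h
    · rename_i h2
      obtain ⟨-, -, b⟩ := reversing_spec a1 a2 h2
      rw [pos_nil, one_mul] at a3
      rw [pos_nil, mul_one, mul_one, a3] at b
      exact (mul_eq_right.1 b.symm)
    · simp at h
  · simp at h

/-! ### Reflection -/

/-- The inverse of a word. -/
def wordInv (w : List (Bool × ℕ × ℕ)) : List (Bool × ℕ × ℕ) :=
  (w.map fun x => (!x.1, x.2)).reverse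

theorem eval_append (v w : List (Bool × ℕ × ℕ)) : eval (v ++ w) = eval v * eval w := by
  simp [eval]

theorem eval_wordInv (w : List (Bool × ℕ × ℕ)) : eval (wordInv w) = (eval w)⁻¹ := by
  induction w with
  | nil => simp [wordInv, eval]
  | cons x w ih =>
    have : wordInv (x :: w) = wordInv w ++ [(!x.1, x.2)] := by simp [wordInv]
    rw [this, eval_append, ih, eval_cons, eval_cons, mul_inv_rev]
    obtain ⟨s, x⟩ := x
    cases s <;> simp [eval, evalLetter]

theorem halfTwist_congr {f g : ℕ → Bool} {a b : ℕ} (h : ∀ k, a < k → k < b → f k = g k) :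
    halfTwist f a b = halfTwist g a b := by
  unfold halfTwist
  congr 2
  refine List.map_congr_left fun k hk => ?_
  rw [List.Ico.mem] at hk
  rw [h k (by omega) (by omega)]

theorem T_eq_σ {j : ℕ} (hj : 1 ≤ j) : T j = σ (u j) := by
  have e : v j = u j + 1 := by simp only [u, v]; omega
  rw [T, Z, e, halfTwist_succ_self]

theorem Z_succ (a : ℕ) : Z a (a + 1) = σ a := halfTwist_succ_self _ a

/-- The path above `i'` is not a letter `Z a b`; conjugating by `T i` expresses it in letters, both
for the computations and for the doubling criterion. -/
theorem branchPair_eq {i j : ℕ} (hi : 1 ≤ i) (hij : i < j) (hj : j ≤ 24) :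
    branchPair i j = [conj (Z (v i) (v j)) (T i), Z (v i) (u j)] := by
  have e : v i = u i + 1 := by simp only [u, v]; omega
  have h := halfTwist_left (above := fun k => decide (k = v i)) (a := u i) (b := v j)
    (by simp only [u]; omega) (by simp only [u, v]; omega) (by simp only [v]; omega)
  rw [← e] at h
  simp only [decide_true, cond_true] at h
  have h' : Z (v i) (v j) = halfTwist (fun k => decide (k = v i)) (v i) (v j) :=
    halfTwist_congr fun k hk _ => by simp; omega
  rw [branchPair, T_eq_σ hi, h', h, conj_inv_conj]

/-- The word of `x ^ b`. -/
def wordConj (x b : List (Bool × ℕ × ℕ)) : List (Bool × ℕ × ℕ) := wordInv b ++ x ++ b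

/-- The words of `Z2 x y`. -/
def wordsZ2 (x y : List ℕ) : List (List (Bool × ℕ × ℕ)) :=
  x.flatMap fun a => y.map fun b => [(true, a, b), (true, a, b)]

/-- The word of `Zbar a b`. -/
def wordZbar (a b : ℕ) : List (Bool × ℕ × ℕ) :=
  wordConj [(true, a, a + 1)] ((List.Ico (a + 1) b).map fun k => (false, k, k + 1))

/-- The words of `Z2bar x y`. -/
def wordsZ2bar (x y : List ℕ) : List (List (Bool × ℕ × ℕ)) :=
  x.reverse.flatMap fun a => y.reverse.map fun b => wordZbar a b ++ wordZbar a b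

/-- The words of `cusps z t`. -/
def wordsCusps (z t : List (Bool × ℕ × ℕ)) : List (List (Bool × ℕ × ℕ)) :=
  [wordConj (z ++ z ++ z) t, z ++ z ++ z, wordConj (z ++ z ++ z) (wordInv t)]

theorem eval_flatten (ws : List (List (Bool × ℕ × ℕ))) :
    eval ws.flatten = (ws.map eval).prod := by
  induction ws with
  | nil => rfl
  | cons w ws ih => simp [eval_append, ih]

theorem Z_eq_eval (a b : ℕ) : Z a b = eval [(true, a, b)] := by simp [eval, evalLetter]

theorem mul_eq_eval (x y : List (Bool × ℕ × ℕ)) : eval x * eval y = eval (x ++ y) :=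
  (eval_append x y).symm

theorem inv_eq_eval (x : List (Bool × ℕ × ℕ)) : (eval x)⁻¹ = eval (wordInv x) :=
  (eval_wordInv x).symm

theorem sq_eq_eval (x : List (Bool × ℕ × ℕ)) : eval x ^ 2 = eval (x ++ x) := by
  rw [eval_append, pow_two]

theorem conj_eq_eval (x b : List (Bool × ℕ × ℕ)) :
    conj (eval x) (eval b) = eval (wordConj x b) := by
  simp only [wordConj, eval_append, eval_wordInv, conj]

theorem T_eq_eval (j : ℕ) : T j = eval [(true, u j, v j)] := Z_eq_eval _ _

theorem Zbar_eq_eval (a b : ℕ) : Zbar a b = eval (wordZbar a b) := by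
  rw [wordZbar, ← conj_eq_eval, ← Z_eq_eval, Z_succ]
  simp [Zbar, halfTwist, eval, evalLetter, Z_succ, Function.comp_def]

theorem Z2_eq_map (x y : List ℕ) : Z2 x y = (wordsZ2 x y).map eval := by
  simp only [Z2, nodesAlong, wordsZ2, List.map_flatMap, List.map_map]
  congr! 3 with a b
  ext b
  change Z a b ^ 2 = _
  rw [Z_eq_eval, sq_eq_eval]; rfl

theorem full_eq_eval (x y : List ℕ) : full x y = eval (wordsZ2 x y).flatten := by
  rw [full, Z2_eq_map, eval_flatten]

theorem Z2bar_eq_map (x y : List ℕ) : Z2bar x y = (wordsZ2bar x y).map eval := by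
  simp only [Z2bar, nodesAlong, wordsZ2bar, List.map_flatMap, List.map_map]
  congr! 3 with a b
  ext b
  change Zbar a b ^ 2 = _
  rw [Zbar_eq_eval, sq_eq_eval]; rfl

theorem cusps_eq_map (z t : List (Bool × ℕ × ℕ)) :
    cusps (eval z) (eval t) = (wordsCusps z t).map eval := by
  have : eval z ^ 3 = eval (z ++ z ++ z) := by
    rw [pow_succ, sq_eq_eval, ← eval_append]
  simp only [cusps, this, inv_eq_eval, conj_eq_eval, wordsCusps, List.map_cons, List.map_nil]

/-- Reified factorized expressions. -/
inductive Factors : Type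
  | words (ws : List (List (Bool × ℕ × ℕ))) : Factors
  | append (e f : Factors) : Factors
  | conj (e : Factors) (b : List (Bool × ℕ × ℕ)) : Factors

namespace Factors

/-- The factorized expression. -/
def toList : Factors → List B
  | words ws => ws.map eval
  | append e f => e.toList ++ f.toList
  | conj e b => conjList e.toList (eval b)

/-- A word of the product. -/
def prodWord : Factors → List (Bool × ℕ × ℕ)
  | words ws => ws.flatten
  | append e f => e.prodWord ++ f.prodWord
  | conj e b => wordConj e.prodWord b

/-- Whether all letters satisfy `p`. -/
def all (p : ℕ × ℕ → Bool) : Factors → Bool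
  | words ws => ws.all fun w => w.all fun x => p x.2
  | append e f => e.all p && f.all p
  | conj e b => e.all p && b.all fun x => p x.2

theorem prod_toList (e : Factors) : e.toList.prod = eval e.prodWord := by
  induction e with
  | words ws => exact (eval_flatten ws).symm
  | append e f he hf => rw [toList, prodWord, List.prod_append, he, hf, eval_append]
  | conj e b he => rw [toList, prodWord, prod_conjList, he, conj_eq_eval]

theorem commute_eval {h : B} {w : List (Bool × ℕ × ℕ)}
    (H : ∀ x ∈ w, Commute (Z x.2.1 x.2.2) h) : Commute (eval w) h := by
  refine Commute.list_prod_left _ _ fun x hx => ?_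
  obtain ⟨⟨s, y⟩, hy, rfl⟩ := List.mem_map.1 hx
  cases s
  · exact (H _ hy).inv_left
  · exact H _ hy

theorem commute_of_all {p : ℕ × ℕ → Bool} {h : B} (H : ∀ x, p x = true → Commute (Z x.1 x.2) h)
    {e : Factors} (he : e.all p = true) : ∀ x ∈ e.toList, Commute x h := by
  induction e with
  | words ws =>
    simp only [all, List.all_eq_true] at he
    intro x hx
    obtain ⟨w, hw, rfl⟩ := List.mem_map.1 hx
    exact commute_eval fun y hy => H _ (he w hw y hy)
  | append e f ihe ihf =>
    rw [all, Bool.and_eq_true] at he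
    intro x hx
    rcases List.mem_append.1 hx with hx | hx
    exacts [ihe he.1 x hx, ihf he.2 x hx]
  | conj e b ih =>
    rw [all, Bool.and_eq_true, List.all_eq_true] at he
    intro x hx
    obtain ⟨y, hy, rfl⟩ := List.mem_map.1 hx
    have hb : Commute (eval b) h := commute_eval fun z hz => H _ (he.2 z hz)
    exact (hb.inv_left.mul_left (ih he.1 y hy)).mul_left hb

end Factors

theorem Z2_eq_toList (x y : List ℕ) : Z2 x y = (Factors.words (wordsZ2 x y)).toList :=
  Z2_eq_map x y

theorem Z2bar_eq_toList (x y : List ℕ) : Z2bar x y = (Factors.words (wordsZ2bar x y)).toList :=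
  Z2bar_eq_map x y

theorem cusps_eq_toList (z t : List (Bool × ℕ × ℕ)) :
    cusps (eval z) (eval t) = (Factors.words (wordsCusps z t)).toList := cusps_eq_map z t

theorem conjList_eq_toList (e : Factors) (b : List (Bool × ℕ × ℕ)) :
    conjList e.toList (eval b) = (e.conj b).toList := rfl

theorem append_eq_toList (e f : Factors) : e.toList ++ f.toList = (e.append f).toList := rfl

theorem singleton_eq_toList (x : List (Bool × ℕ × ℕ)) :
    [eval x] = (Factors.words [x]).toList := rfl

theorem cons_eq_toList (x : List (Bool × ℕ × ℕ)) (w : List (List (Bool × ℕ × ℕ))) :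
    eval x :: (Factors.words w).toList = (Factors.words (x :: w)).toList := rfl

/-! ### Local full twists as powers of a rotation. -/

/-- The positions of the points of some lines. -/
def positions (s : List ℕ) : List ℕ := s.flatMap fun j => [u j, v j]

/-- A word of the product of the halftwists of consecutive points of some lines. -/
def rotation (s : List ℕ) : List (Bool × ℕ × ℕ) :=
  ((positions s).zip (positions s).tail).map fun x => (true, x)

/-- A word of the full twist of the points of some lines. -/
def fullTwist (s : List ℕ) : List (Bool × ℕ × ℕ) :=
  (List.replicate (positions s).length (rotation s)).flatten

/-- The word of `∏ T j`. -/
def wordT (s : List ℕ) : List (Bool × ℕ × ℕ) := s.map fun j => (true, u j, v j)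

/-- Whether the halftwist `x` moves two of the points of the lines in `s`. -/
def isAmong (s : List ℕ) (x : ℕ × ℕ) : Bool :=
  decide (IsLetter x) && ((positions s).elem x.1 && (positions s).elem x.2)

/-- The successor of `a` in the cyclic order of the list `l`. -/
def next (l : List ℕ) (a : ℕ) : ℕ := ((l.zip (l.tail ++ l.take 1)).lookup a).getD 0

/-- The pair of points to which a rotation moves the pair `x`. -/
def rotate (s : List ℕ) (x : ℕ × ℕ) : ℕ × ℕ :=
  bif (next (positions s) x.1).ble (next (positions s) x.2) then
    (next (positions s) x.1, next (positions s) x.2)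
  else (next (positions s) x.2, next (positions s) x.1)

/-- Whether the rotation acts on the halftwists as on pairs of points. -/
def isRotation (s : List ℕ) : Bool :=
  (positions s).all fun a => (positions s).all fun b => !isAmong s (a, b) ||
    (isAmong s (rotate s (a, b)) &&
      (isTrivial (rotation s ++ [(true, a, b)] ++ wordInv (rotation s) ++
        [(false, rotate s (a, b))]) &&
      decide ((rotate s)^[(positions s).length] (a, b) = (a, b))))

theorem rotation_mul_Z {s : List ℕ} (hs : isRotation s = true) {x : ℕ × ℕ}
    (hx : isAmong s x = true) :
    isAmong s (rotate s x) = true ∧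
    eval (rotation s) * Z x.1 x.2 = Z (rotate s x).1 (rotate s x).2 * eval (rotation s) ∧
      (rotate s)^[(positions s).length] x = x := by
  simp only [isRotation, List.all_eq_true] at hs
  have h := hx
  simp only [isAmong, Bool.and_eq_true, List.elem_iff] at h
  have := hs _ h.2.1 _ h.2.2
  simp only [hx, Bool.not_true, Bool.false_or, Bool.and_eq_true, decide_eq_true_eq] at this
  refine ⟨this.1, ?_, this.2.2⟩
  have e := eval_eq_one this.2.1
  rw [eval_append, eval_append, eval_append, eval_wordInv, ← Z_eq_eval, mul_eq_one_iff_eq_inv,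
    mul_inv_eq_iff_eq_mul] at e
  rw [e]
  simp [eval, evalLetter]

/-- Conjugation by the rotation permutes the halftwists like the chords of a polygon, and after as
many steps as there are points every chord is back in place. The permutation is verified by
`isRotation`. -/
theorem commute_fullTwist {s : List ℕ} (hs : isRotation s = true) {x : ℕ × ℕ}
    (hx : isAmong s x = true) : Commute (Z x.1 x.2) (eval (fullTwist s)) := by
  have key : ∀ (n : ℕ) (x : ℕ × ℕ), isAmong s x = true →
      eval (rotation s) ^ n * Z x.1 x.2 =
        Z ((rotate s)^[n] x).1 ((rotate s)^[n] x).2 * eval (rotation s) ^ n := by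
    intro n
    induction n with
    | zero => simp
    | succ n ih =>
      intro x hx
      obtain ⟨h1, h2, -⟩ := rotation_mul_Z hs hx
      rw [pow_succ, mul_assoc, h2, ← mul_assoc, ih _ h1, mul_assoc, Function.iterate_succ_apply]
  have h := key (positions s).length x hx
  rw [(rotation_mul_Z hs hx).2.2] at h
  have e : eval (fullTwist s) = eval (rotation s) ^ (positions s).length := by
    rw [fullTwist, eval_flatten, List.map_replicate, List.prod_replicate]
  rw [e]
  exact h.symm

/-- Elements whose letters belong to some lines commute with the full twist of these lines. -/
theorem commute_of_isTrivial {s : List ℕ} {e : Factors} {w : List (Bool × ℕ × ℕ)}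
    (he : e.all (isAmong s) = true) (hs : isRotation s = true)
    (hw : isTrivial (w ++ wordInv (fullTwist s)) = true) : ∀ x ∈ e.toList, Commute x (eval w) := by
  have h := eval_eq_one hw
  rw [eval_append, eval_wordInv, mul_inv_eq_one] at h
  rw [h]
  exact Factors.commute_of_all (fun x hx => commute_fullTwist hs hx) he

/-! ### Invariance of the regenerated factors -/

/-- Hurwitz moves preserve the product. The invariance of nodes thus also yields that the full
twists used as exponents commute with `T`. -/
theorem commute_prod_of_mem_invariance {G : Type*} [Group G] {l : List G} {h : G}
    (H : h ∈ invariance l) : Commute l.prod h := by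
  have key : ∀ {m n : List G}, HurwitzEquiv m n → m.prod = n.prod := by
    intro m n e
    induction e with
    | refl => rfl
    | tail _ h ih => rw [ih]; cases h <;> simp [mul_assoc]
  have := key (mem_invariance.1 H)
  rw [prod_conjList, conj, mul_assoc, eq_inv_mul_iff_mul_eq] at this
  exact this.symm

theorem commute_T {i j : ℕ} (hi : 1 ≤ i) (hj : 1 ≤ j) : Commute (T i) (T j) := by
  rw [T_eq_σ hi, T_eq_σ hj]
  rcases lt_trichotomy i j with h | rfl | h
  · exact commute_σ (by simp only [u]; omega) (by simp only [u]; omega)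
  · exact Commute.refl _
  · exact (commute_σ (by simp only [u]; omega) (by simp only [u]; omega)).symm

/-- The positions `a < b` are not those of the points `s`, `s'`. -/
def Avoids (s a b : ℕ) : Prop :=
  1 ≤ s ∧ 1 ≤ a ∧ a < b ∧ b ≤ 48 ∧ a ≠ u s ∧ a ≠ v s ∧ b ≠ u s ∧ b ≠ v s

instance (s a b : ℕ) : Decidable (Avoids s a b) :=
  inferInstanceAs (Decidable (_ ∧ _ ∧ _ ∧ _ ∧ _ ∧ _ ∧ _ ∧ _))

/-- `T s` twists along the short segment from `s` to `s'`, which the path avoids because it passes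
both points on the same side. -/
theorem commute_halfTwist_T {above : ℕ → Bool} {s a b : ℕ} (h : Avoids s a b)
    (hs : above (u s) = above (v s)) : Commute (halfTwist above a b) (T s) := by
  obtain ⟨h1, h2, h3, h4, h5⟩ := h
  have e : v s = u s + 1 := by simp only [u, v]; omega
  have e' : 1 ≤ u s := by simp only [u]; omega
  rw [T_eq_σ h1]
  rcases lt_trichotomy b (u s) with h | h | h
  · exact commute_halfTwist_σ_outside h2 h3 e' (by omega)
  · omega
  · rcases lt_trichotomy a (u s) with h' | h' | h'
    · exact commute_halfTwist_σ_between h2 h' (by omega) h4 (e ▸ hs)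
    · omega
    · exact commute_halfTwist_σ_outside h2 h3 e' (by omega)

theorem commute_Z_T {s a b : ℕ} (h : Avoids s a b) : Commute (Z a b) (T s) :=
  commute_halfTwist_T h rfl

theorem commute_Zbar_T {s a b : ℕ} (h : Avoids s a b) : Commute (Zbar a b) (T s) :=
  commute_halfTwist_T h rfl

theorem braided_halfTwist_T_left {above : ℕ → Bool} {i b : ℕ} (hi : 1 ≤ i) (hb : v i < b)
    (hb' : b ≤ 48) : Braided (halfTwist above (u i) b) (T i) := by
  rw [T_eq_σ hi]
  simp only [v] at hb
  exact braided_halfTwist_σ_left (by simp only [u]; omega) (by simp only [u]; omega) hb'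

theorem braided_halfTwist_T_right {above : ℕ → Bool} {a j : ℕ} (ha : 1 ≤ a) (haj : a < u j)
    (hj : j ≤ 24) : Braided (halfTwist above a (u j)) (T j) := by
  simp only [u] at haj
  rw [T_eq_σ (by omega)]
  exact braided_halfTwist_σ ha (by simp only [u]; omega) (by simp only [u]; omega)

theorem halfTwist_v_left {above : ℕ → Bool} {i b : ℕ} (hi : 1 ≤ i) (hb : v i < b)
    (hb' : b ≤ 48) :
    halfTwist above (v i) b =
      conj (halfTwist above (u i) b) (bif above (v i) then (T i)⁻¹ else T i) := by
  have e : v i = u i + 1 := by simp only [u, v]; omega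
  rw [T_eq_σ hi, e]
  exact halfTwist_left (by simp only [u]; omega) (by omega) hb'

theorem halfTwist_v_right {above : ℕ → Bool} {a j : ℕ} (ha : 1 ≤ a) (haj : a < u j) :
    halfTwist above a (v j) =
      conj (halfTwist above a (u j)) (bif above (u j) then (T j)⁻¹ else T j) := by
  have hj : 1 ≤ j := by simp only [u] at haj; omega
  have e : v j = u j + 1 := by simp only [u, v]; omega
  rw [T_eq_σ hj, e, halfTwist_succ _ haj, slide]

theorem nodesAlong_avoids {above : ℕ → Bool} {s : ℕ} {x y : List ℕ}
    (h : ∀ a ∈ x, ∀ b ∈ y, Avoids s a b) (hs : above (u s) = above (v s)) :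
    T s ∈ invariance (nodesAlong above x y) := by
  refine mem_invariance_of_commute fun z hz => ?_
  simp only [nodesAlong, List.mem_flatMap, List.mem_map] at hz
  obtain ⟨a, ha, b, hb, rfl⟩ := hz
  exact (commute_halfTwist_T (h a ha b hb) hs).pow_left 2

theorem sq_singleton_spec {G : Type*} [Group G] (z : G) :
    (∀ x ∈ [z ^ 2], ∃ n : ℕ, x = z ^ n) ∧ [z ^ 2].prod = z ^ 2 := by simp

/-- Nodes of a single line and a doubled line. -/
theorem nodesAlong_left {above : ℕ → Bool} {i b : ℕ} (hi : 1 ≤ i) (hb : v i < b) (hb' : b ≤ 48)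
    (h : above (v i) = false) : T i ∈ invariance (nodesAlong above (dbl i) [b]) := by
  have e := halfTwist_v_left (above := above) hi hb hb'
  rw [h, cond_false] at e
  have := (braided_halfTwist_T_left (above := above) hi hb hb').pair_mem_invariance
    (sq_singleton_spec _).1 (sq_singleton_spec _).2
  simpa [nodesAlong, dbl, e, conjList, conj_pow] using this

theorem nodesAlong_right {above : ℕ → Bool} {a j : ℕ} (ha : 1 ≤ a) (haj : a < u j) (hj : j ≤ 24)
    (h : above (u j) = false) : T j ∈ invariance (nodesAlong above [a] (dbl j)) := by
  have e := halfTwist_v_right (above := above) ha haj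
  rw [h, cond_false] at e
  have := (braided_halfTwist_T_right (above := above) ha haj hj).pair_mem_invariance
    (sq_singleton_spec _).1 (sq_singleton_spec _).2
  simpa [nodesAlong, dbl, e, conjList, conj_pow] using this

/-- Above the axis the point `j` is reached from `j'` by conjugation with `T j`, so the doubled form
`l ^ T j · l` starts from the node at `j'` and the order is reversed. -/
theorem nodesAlong_right_reverse {above : ℕ → Bool} {a j : ℕ} (ha : 1 ≤ a) (haj : a < u j)
    (hj : j ≤ 24) (h : above (u j) = true) :
    T j ∈ invariance (nodesAlong above [a] (dbl j).reverse) := by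
  have e := halfTwist_v_right (above := above) ha haj
  rw [h, cond_true] at e
  have hb := (braided_halfTwist_T_right (above := above) ha haj hj).conj (T j)⁻¹
  rw [conj_eq_self (x := T j) (Commute.refl _).inv_right, ← e] at hb
  have := hb.pair_mem_invariance (sq_singleton_spec _).1 (sq_singleton_spec _).2
  simpa [nodesAlong, dbl, e, conjList, conj_pow, conj_inv_conj] using this

/-- Nodes of two doubled lines. -/
theorem nodesAlong_dbl {above : ℕ → Bool} {i j : ℕ} (hi : 1 ≤ i) (hij : i < j) (hj : j ≤ 24)
    (h : above (v i) = false) (h' : above (u j) = false) :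
    T i ∈ invariance (nodesAlong above (dbl i) (dbl j)) ∧
      T j ∈ invariance (nodesAlong above (dbl i) (dbl j)) := by
  have h0 : 1 ≤ u i := by simp only [u]; omega
  have h1 : v i < u j := by simp only [u, v]; omega
  have h2 : u i < u j := by simp only [u]; omega
  have h3 : u j ≤ 48 := by simp only [u]; omega
  have h4 : u j < v j := by simp only [u, v]; omega
  have h5 : v j ≤ 48 := by simp only [v]; omega
  have e1 := halfTwist_v_left (above := above) hi h1 h3
  have e2 := halfTwist_v_right (above := above) h0 h2
  have e3 := halfTwist_v_left (above := above) hi (h1.trans h4) h5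
  rw [h, cond_false] at e1 e3
  rw [h', cond_false] at e2
  rw [e2, conj_conj, (commute_T (i := j) (j := i) (by omega) hi).eq] at e3
  have := (braided_halfTwist_T_left (above := above) hi h1 h3).quadruple_mem_invariance
    (braided_halfTwist_T_right (above := above) h0 h2 hj) (commute_T hi (by omega))
    (sq_singleton_spec _).1 (sq_singleton_spec _).2
  simpa [nodesAlong, dbl, e1, e2, e3, conjList, conj_pow] using this

theorem nodesAlong_dbl_reverse {above : ℕ → Bool} {i j : ℕ} (hi : 1 ≤ i) (hij : i < j)
    (hj : j ≤ 24) (h : above (v i) = true) (h' : above (u j) = true) :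
    T i ∈ invariance (nodesAlong above (dbl i).reverse (dbl j).reverse) ∧
      T j ∈ invariance (nodesAlong above (dbl i).reverse (dbl j).reverse) := by
  have h0 : 1 ≤ u i := by simp only [u]; omega
  have h1 : v i < u j := by simp only [u, v]; omega
  have h2 : u i < u j := by simp only [u]; omega
  have h3 : u j ≤ 48 := by simp only [u]; omega
  have h4 : u j < v j := by simp only [u, v]; omega
  have h5 : v j ≤ 48 := by simp only [v]; omega
  have c := commute_T (i := i) (j := j) hi (by omega)
  have e1 := halfTwist_v_left (above := above) hi h1 h3
  have e2 := halfTwist_v_right (above := above) h0 h2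
  have e3 := halfTwist_v_left (above := above) hi (h1.trans h4) h5
  rw [h, cond_true] at e1 e3
  rw [h', cond_true] at e2
  rw [e2, conj_conj] at e3
  -- Above the axis the base halftwist of the quadruple is the one from `i'` to `j'`, so the braid
  -- relations are transported to it.
  have b1 := (braided_halfTwist_T_left (above := above) hi h1 h3).conj ((T j)⁻¹ * (T i)⁻¹)
  have b2 := (braided_halfTwist_T_right (above := above) h0 h2 hj).conj ((T j)⁻¹ * (T i)⁻¹)
  rw [conj_eq_self (x := T i) (c.inv_right.mul_right (Commute.refl _).inv_right), ← e3] at b1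
  rw [conj_eq_self (x := T j) ((Commute.refl _).inv_right.mul_right c.symm.inv_right), ← e3] at b2
  have := b1.quadruple_mem_invariance b2 c (sq_singleton_spec _).1 (sq_singleton_spec _).2
  have f1 : (T j)⁻¹ * ((T i)⁻¹ * (T i * T j)) = 1 := by simp
  have f2 : (T j)⁻¹ * ((T i)⁻¹ * T i) = (T j)⁻¹ := by simp
  have f3 : (T j)⁻¹ * ((T i)⁻¹ * T j) = (T i)⁻¹ := by
    rw [← mul_assoc, ← (c.inv_inv).eq, mul_assoc]; simp
  simpa [-inv_mul_cancel_left, -inv_mul_cancel, nodesAlong, dbl, e1, e2, e3,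
    conjList, conj_pow, conj_conj, mul_assoc, f1, f2, f3, conj_one] using this

theorem Z2_left {i b : ℕ} (h : 1 ≤ i ∧ v i < b ∧ b ≤ 48) : T i ∈ invariance (Z2 (dbl i) [b]) :=
  nodesAlong_left h.1 h.2.1 h.2.2 rfl

theorem Z2_right {a j : ℕ} (h : 1 ≤ a ∧ a < u j ∧ u j ≤ 48) :
    T j ∈ invariance (Z2 [a] (dbl j)) :=
  nodesAlong_right h.1 h.2.1 (by simp only [u] at h; omega) rfl

theorem Z2_avoids {s : ℕ} {x y : List ℕ} (h : ∀ a ∈ x, ∀ b ∈ y, Avoids s a b) :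
    T s ∈ invariance (Z2 x y) := nodesAlong_avoids h rfl

theorem Z2bar_right {a j : ℕ} (h : 1 ≤ a ∧ a < u j ∧ u j ≤ 48) :
    T j ∈ invariance (Z2bar [a] (dbl j)) :=
  nodesAlong_right_reverse h.1 h.2.1 (by simp only [u] at h; omega) rfl

theorem Z2bar_avoids {s : ℕ} {x y : List ℕ} (h : ∀ a ∈ x.reverse, ∀ b ∈ y.reverse, Avoids s a b) :
    T s ∈ invariance (Z2bar x y) := nodesAlong_avoids h rfl

theorem commute_full_left {i b : ℕ} (h : 1 ≤ i ∧ v i < b ∧ b ≤ 48) :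
    Commute (full (dbl i) [b]) (T i) := commute_prod_of_mem_invariance (Z2_left h)

theorem commute_full_right {a j : ℕ} (h : 1 ≤ a ∧ a < u j ∧ u j ≤ 48) :
    Commute (full [a] (dbl j)) (T j) := commute_prod_of_mem_invariance (Z2_right h)

theorem commute_full_dbl_left {i j : ℕ} (h : 1 ≤ i ∧ i < j ∧ j ≤ 24) :
    Commute (full (dbl i) (dbl j)) (T i) :=
  commute_prod_of_mem_invariance (nodesAlong_dbl h.1 h.2.1 h.2.2 rfl rfl).1

theorem commute_full_dbl_right {i j : ℕ} (h : 1 ≤ i ∧ i < j ∧ j ≤ 24) :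
    Commute (full (dbl i) (dbl j)) (T j) :=
  commute_prod_of_mem_invariance (nodesAlong_dbl h.1 h.2.1 h.2.2 rfl rfl).2

theorem commute_full_avoids {s : ℕ} {x y : List ℕ} (h : ∀ a ∈ x, ∀ b ∈ y, Avoids s a b) :
    Commute (full x y) (T s) := commute_prod_of_mem_invariance (Z2_avoids h)

theorem commute_conj_left {G : Type*} [Group G] {x b h : G} (hx : Commute x h)
    (hb : Commute b h) : Commute (conj x b) h := (hb.inv_left.mul_left hx).mul_left hb

theorem cusps_mem_of_commute {z t h : B} (hz : Commute z h) (ht : Commute t h) :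
    h ∈ invariance (cusps z t) := by
  refine mem_invariance_of_commute fun x hx => ?_
  simp only [cusps, List.mem_cons, List.not_mem_nil, or_false] at hx
  rcases hx with rfl | rfl | rfl
  · exact commute_conj_left (hz.pow_left 3) ht
  · exact hz.pow_left 3
  · exact commute_conj_left (hz.pow_left 3) ht.inv_left

theorem Z3l_mem {i b : ℕ} (h : 1 ≤ i ∧ v i < b ∧ b ≤ 48) : T i ∈ invariance (Z3l i b) :=
  cusps_mem_invariance (braided_halfTwist_T_left h.1 h.2.1 h.2.2)

theorem Z3lbar_mem {i b : ℕ} (h : 1 ≤ i ∧ v i < b ∧ b ≤ 48) : T i ∈ invariance (Z3lbar i b) :=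
  cusps_mem_invariance (braided_halfTwist_T_left h.1 h.2.1 h.2.2)

theorem Z3r_mem {a j : ℕ} (h : 1 ≤ a ∧ a < u j ∧ u j ≤ 48) : T j ∈ invariance (Z3r a j) :=
  cusps_mem_invariance
    (braided_halfTwist_T_right h.1 h.2.1 (by simp only [u] at h; omega))

theorem Z3rbar_mem {a j : ℕ} (h : 1 ≤ a ∧ a < u j ∧ u j ≤ 48) : T j ∈ invariance (Z3rbar a j) :=
  cusps_mem_invariance
    (braided_halfTwist_T_right h.1 h.2.1 (by simp only [u] at h; omega))

theorem Z3l_avoids {s i b : ℕ} (h : 1 ≤ i ∧ Avoids s (u i) b) : T s ∈ invariance (Z3l i b) :=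
  cusps_mem_of_commute (commute_Z_T h.2) (commute_T h.1 h.2.1)

theorem Z3lbar_avoids {s i b : ℕ} (h : 1 ≤ i ∧ Avoids s (u i) b) :
    T s ∈ invariance (Z3lbar i b) :=
  cusps_mem_of_commute (commute_Zbar_T h.2) (commute_T h.1 h.2.1)

theorem Z3r_avoids {s a j : ℕ} (h : 1 ≤ j ∧ Avoids s a (u j)) : T s ∈ invariance (Z3r a j) :=
  cusps_mem_of_commute (commute_Z_T h.2) (commute_T h.1 h.2.1)

theorem Z3rbar_avoids {s a j : ℕ} (h : 1 ≤ j ∧ Avoids s a (u j)) :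
    T s ∈ invariance (Z3rbar a j) :=
  cusps_mem_of_commute (commute_Zbar_T h.2) (commute_T h.1 h.2.1)

theorem singleton_T_mem {i j : ℕ} (h : 1 ≤ i ∧ 1 ≤ j) : T j ∈ invariance [T i] :=
  mem_invariance_of_commute (by simpa using commute_T h.1 h.2)

/-- The pair is `z` conjugated by `T i * T j`, followed by `z`, with `z = Z (v i) (u j)`. The
halftwists act only jointly. -/
theorem branchPair_mem {i j : ℕ} (h : 1 ≤ i ∧ i < j ∧ j ≤ 24) :
    T i * T j ∈ invariance (branchPair i j) := by
  obtain ⟨hi, hij, hj⟩ := h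
  have h0 : 1 ≤ v i := by simp only [v]; omega
  have h1 : v i < u j := by simp only [u, v]; omega
  have h3 : u j ≤ 48 := by simp only [u]; omega
  have c := commute_T (i := i) (j := j) hi (by omega)
  have e1 : Z (v i) (u j) = conj (Z (u i) (u j)) (T i) := halfTwist_v_left hi h1 h3
  have e2 : Z (v i) (v j) = conj (Z (v i) (u j)) (T j) := halfTwist_v_right h0 h1
  have b1 := (braided_halfTwist_T_left (above := fun _ => false) hi h1 h3).conj (T i)
  rw [conj_eq_self (x := T i) (Commute.refl _)] at b1
  change Braided (conj (Z (u i) (u j)) (T i)) (T i) at b1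
  rw [← e1] at b1
  have b2 : Braided (Z (v i) (u j)) (T j) := braided_halfTwist_T_right h0 h1 hj
  rw [branchPair_eq hi hij hj, e2, conj_conj, ← c.eq]
  exact b1.branch_mem_invariance b2 c

theorem twice_mem {F : List B} {h : B} {a b : ℕ} (hF : h ∈ invariance F) (ha : Commute (T a) h)
    (hb : Commute (T b) h) : h ∈ invariance (twice F a b) :=
  append_mem_invariance hF
    (conjList_mem_invariance hF (hb.inv_left.mul_left ha.inv_left))

/-! ### Invariance read off from the product of a local factorization. -/

theorem eval_wordT_append (s t : List ℕ) :
    eval (wordT (s ++ t)) = eval (wordT s) * eval (wordT t) := by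
  rw [wordT, List.map_append, eval_append]; rfl

theorem eval_wordT_pair (i j : ℕ) : eval (wordT [i, j]) = T i * T j := by
  simp [wordT, eval, evalLetter, T]

/-- The invariance of `F · F^{T b⁻¹ T a⁻¹}` under `T a * T b`. -/
theorem twice_mem_of_isTrivial {F : List B} {a b c d : ℕ} {s : List ℕ} {e : Factors}
    (he : F = e.toList ∧ e.all (isAmong s) = true ∧ isRotation s = true ∧
      isTrivial (e.prodWord ++ wordT [a, b] ++ e.prodWord ++ wordT [a, b] ++
        (wordT [c, d] ++ wordT [c, d]) ++ wordInv (fullTwist s)) = true)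
    (hF : T c * T d ∈ invariance F) : T a * T b ∈ invariance (twice F a b) := by
  obtain ⟨h1, h2, h3, h4⟩ := he
  have h := mem_invariance_of_commute (commute_of_isTrivial h2 h3 h4)
  rw [eval_append, eval_append, eval_append, eval_append, eval_append, ← Factors.prod_toList,
    eval_wordT_pair, eval_wordT_pair, ← h1] at h
  -- The full twist leaves `F` invariant, and so does the square of `T c * T d`; what remains is the
  -- square of `F.prod * (T a * T b)`.
  have := (Subgroup.mul_mem_cancel_right _ (mul_mem hF hF)).1 h
  have := append_conjList_inv_mem_invariance this
  rwa [mul_inv_rev] at this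

/-- The invariance under the halftwists of the conics. -/
theorem wordT_mem_of_isTrivial {l : List B} {s t : List ℕ} {e : Factors}
    (he : l = e.toList ∧ e.all (isAmong s) = true ∧ isRotation s = true ∧
      isTrivial (e.prodWord ++ wordT t ++ wordInv (fullTwist s)) = true) :
    eval (wordT t) ∈ invariance l := by
  obtain ⟨h1, h2, h3, h4⟩ := he
  have h := mem_invariance_of_commute (commute_of_isTrivial h2 h3 h4)
  rw [eval_append, ← Factors.prod_toList, ← h1] at h
  exact (Subgroup.mul_mem_cancel_left _ (prod_mem_invariance l)).1 h

/-- All letters run below the axis, hence on the same side of `j` and `j'`, and commute with `T j`.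
-/
theorem T_mem_of_all {l : List B} {s : List ℕ} {e : Factors} (h1 : l = e.toList)
    (h2 : e.all (isAmong s) = true) {j : ℕ} (hj : 1 ≤ j) (hs : u j ∉ positions s)
    (hs' : v j ∉ positions s) : T j ∈ invariance l := by
  rw [h1]
  refine mem_invariance_of_commute (Factors.commute_of_all (fun x hx => ?_) h2)
  simp only [isAmong, Bool.and_eq_true, decide_eq_true_eq, List.elem_iff] at hx
  obtain ⟨⟨hx1, hx2, hx3⟩, hx4, hx5⟩ := hx
  refine commute_Z_T ⟨hj, hx1, hx2, hx3, ?_, ?_, ?_, ?_⟩ <;> rintro h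
  exacts [hs (h ▸ hx4), hs' (h ▸ hx4), hs (h ▸ hx5), hs' (h ▸ hx5)]

section

attribute [local irreducible] T full Z2 Z2bar Z3l Z3lbar Z3r Z3rbar branchPair conjList invariance

/-- For the lines of the branch pair every block is invariant by itself and the exponents commute
with both halftwists. The other two lines enter the blocks through single points and need the
product argument. -/
theorem F₁_mem {i j k l : ℕ} (h : 1 ≤ i ∧ i < j ∧ j < k ∧ k < l ∧ l ≤ 24) :
    T i * T j ∈ invariance (F₁ i j k l) := by
  unfold F₁
  repeat' first
    | with_reducible apply append_mem_invariance
    | with_reducible apply conjList_mem_invariance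
    -- This must precede the splitting of the product: the other blocks are treated for each
    -- halftwist separately, the branch pair is not.
    | exact branchPair_mem (by omega)
    | with_reducible apply mul_mem
    | with_reducible apply Commute.mul_right
    | with_reducible apply Commute.mul_left
    | exact Z3l_mem (by simp only [u, v]; omega)
    | exact Z3l_avoids (by simp only [Avoids, u, v]; omega)
    | exact Z2_avoids (by simp [pt, pt', Avoids, u, v]; omega)
    | exact commute_full_left (by simp only [u, v]; omega)
    | exact commute_full_avoids (by simp [dbl, pt, Avoids, u, v]; omega)
    | with_reducible apply commute_conj_left

theorem F₂_mem {i j k l : ℕ} (h : 1 ≤ i ∧ i < j ∧ j < k ∧ k < l ∧ l ≤ 24) :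
    T k * T l ∈ invariance (F₂ i j k l) := by
  unfold F₂
  repeat' first
    | with_reducible apply append_mem_invariance
    | with_reducible apply conjList_mem_invariance
    | exact branchPair_mem (by omega)
    | with_reducible apply mul_mem
    | with_reducible apply Commute.mul_right
    | with_reducible apply Commute.mul_left
    | exact Z3r_mem (by simp only [u, v]; omega)
    | exact Z3r_avoids (by simp only [Avoids, u, v]; omega)
    | exact Z2_avoids (by simp [pt, pt', Avoids, u, v]; omega)
    | exact commute_full_right (by simp only [u, v]; omega)
    | exact commute_full_avoids (by simp [dbl, pt, pt', Avoids, u, v]; omega)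
    | with_reducible apply commute_conj_left

theorem F₃_mem {i j k l : ℕ} (h : 1 ≤ i ∧ i < j ∧ j < k ∧ k < l ∧ l ≤ 24) :
    T j * T k ∈ invariance (F₃ i j k l) := by
  unfold F₃
  repeat' first
    | with_reducible apply append_mem_invariance
    | with_reducible apply conjList_mem_invariance
    | exact branchPair_mem (by omega)
    | with_reducible apply mul_mem
    | with_reducible apply Commute.mul_right
    | with_reducible apply Commute.mul_left
    | exact Z3l_mem (by simp only [u, v]; omega)
    | exact Z3l_avoids (by simp only [Avoids, u, v]; omega)
    | exact Z3r_mem (by simp only [u, v]; omega)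
    | exact Z3r_avoids (by simp only [Avoids, u, v]; omega)
    | exact Z2_avoids (by simp [pt, pt', Avoids, u, v]; omega)
    | exact commute_full_left (by simp only [u, v]; omega)
    | exact commute_full_right (by simp only [u, v]; omega)
    | exact commute_full_avoids (by simp [dbl, pt, pt', Avoids, u, v]; omega)

end

/-! ### The products of the local braid monodromies -/

/-- The identity (Π `T a T b`)² (`T c T d`)² = full twist of eight points for the undoubled `F`;
likewise for the five other 6-points. -/
theorem exists_factors_F₁_1_2_13_20 : ∃ e : Factors, F₁ 1 2 13 20 = e.toList ∧
    e.all (isAmong [1, 2, 13, 20]) = true ∧ isRotation [1, 2, 13, 20] = true ∧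
    isTrivial (e.prodWord ++ wordT [13, 20] ++ e.prodWord ++ wordT [13, 20] ++
      (wordT [1, 2] ++ wordT [1, 2]) ++
      wordInv (fullTwist [1, 2, 13, 20])) = true := by
  -- The witness stays open: rewriting turns the expression into `toList` of an explicit term, which
  -- `rfl` then assigns. The word computation is left to the kernel.
  apply Exists.intro
  apply And.intro
  · simp (decide := true) only [F₁, Z3l, branchPair_eq, Z_eq_eval, T_eq_eval, Z2_eq_toList, full_eq_eval, mul_eq_eval,
      conj_eq_eval, cusps_eq_toList, conjList_eq_toList, append_eq_toList, singleton_eq_toList,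
      cons_eq_toList]
    rfl
  · decide +kernel

/-- The product of the local braid monodromy times the halftwists of all its six lines is the full
twist of twelve points; likewise at the other 6-points. -/
theorem exists_factors_phi2 : ∃ e : Factors, phi2 = e.toList ∧
    e.all (isAmong [1, 2, 4, 5, 13, 20]) = true ∧ isRotation [1, 2, 4, 5, 13, 20] = true ∧
    isTrivial (e.prodWord ++ wordT ([4, 5] ++ [1, 2] ++ [13, 20]) ++
      wordInv (fullTwist [1, 2, 4, 5, 13, 20])) = true := by
  apply Exists.intro
  apply And.intro
  · simp (decide := true) only [phi2, phi2.G, twice, F₁, Z3l, Z3r, branchPair_eq, inv_eq_eval, sq_eq_eval, Z_eq_eval,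
      T_eq_eval, Z2_eq_toList, full_eq_eval, mul_eq_eval, conj_eq_eval, cusps_eq_toList,
      conjList_eq_toList, append_eq_toList, singleton_eq_toList, cons_eq_toList]
    rfl
  · decide +kernel

theorem exists_factors_F₂_3_7_15_21 : ∃ e : Factors, F₂ 3 7 15 21 = e.toList ∧
    e.all (isAmong [3, 7, 15, 21]) = true ∧ isRotation [3, 7, 15, 21] = true ∧
    isTrivial (e.prodWord ++ wordT [3, 7] ++ e.prodWord ++ wordT [3, 7] ++
      (wordT [15, 21] ++ wordT [15, 21]) ++
      wordInv (fullTwist [3, 7, 15, 21])) = true := by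
  apply Exists.intro
  apply And.intro
  · simp (decide := true) only [F₂, Z3r, branchPair_eq, Z_eq_eval, T_eq_eval, Z2_eq_toList, full_eq_eval, mul_eq_eval,
      conj_eq_eval, cusps_eq_toList, conjList_eq_toList, append_eq_toList, singleton_eq_toList,
      cons_eq_toList]
    rfl
  · decide +kernel

theorem exists_factors_phi4 : ∃ e : Factors, phi4 = e.toList ∧
    e.all (isAmong [3, 4, 7, 8, 15, 21]) = true ∧ isRotation [3, 4, 7, 8, 15, 21] = true ∧
    isTrivial (e.prodWord ++ wordT ([4, 8] ++ [15, 21] ++ [3, 7]) ++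
      wordInv (fullTwist [3, 4, 7, 8, 15, 21])) = true := by
  apply Exists.intro
  apply And.intro
  · simp (decide := true) only [phi4, phi4.G, twice, F₂, Z3l, Z3r, branchPair_eq, inv_eq_eval, sq_eq_eval, Z_eq_eval,
      T_eq_eval, Z2_eq_toList, full_eq_eval, mul_eq_eval, conj_eq_eval, cusps_eq_toList,
      conjList_eq_toList, append_eq_toList, singleton_eq_toList, cons_eq_toList]
    rfl
  · decide +kernel

theorem exists_factors_F₂_6_11_16_22 : ∃ e : Factors, F₂ 6 11 16 22 = e.toList ∧
    e.all (isAmong [6, 11, 16, 22]) = true ∧ isRotation [6, 11, 16, 22] = true ∧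
    isTrivial (e.prodWord ++ wordT [6, 11] ++ e.prodWord ++ wordT [6, 11] ++
      (wordT [16, 22] ++ wordT [16, 22]) ++
      wordInv (fullTwist [6, 11, 16, 22])) = true := by
  apply Exists.intro
  apply And.intro
  · simp (decide := true) only [F₂, Z3r, branchPair_eq, Z_eq_eval, T_eq_eval, Z2_eq_toList, full_eq_eval, mul_eq_eval,
      conj_eq_eval, cusps_eq_toList, conjList_eq_toList, append_eq_toList, singleton_eq_toList,
      cons_eq_toList]
    rfl
  · decide +kernel

theorem exists_factors_phi5 : ∃ e : Factors, phi5 = e.toList ∧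
    e.all (isAmong [5, 6, 9, 11, 16, 22]) = true ∧ isRotation [5, 6, 9, 11, 16, 22] = true ∧
    isTrivial (e.prodWord ++ wordT ([5, 9] ++ [16, 22] ++ [6, 11]) ++
      wordInv (fullTwist [5, 6, 9, 11, 16, 22])) = true := by
  apply Exists.intro
  apply And.intro
  · simp (decide := true) only [phi5, phi5.G, twice, F₂, Z3r, branchPair_eq, inv_eq_eval, sq_eq_eval, Z_eq_eval,
      T_eq_eval, Z2_eq_toList, full_eq_eval, mul_eq_eval, conj_eq_eval, cusps_eq_toList,
      conjList_eq_toList, append_eq_toList, singleton_eq_toList, cons_eq_toList]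
    rfl
  · decide +kernel

theorem exists_factors_F₁_10_12_18_23 : ∃ e : Factors, F₁ 10 12 18 23 = e.toList ∧
    e.all (isAmong [10, 12, 18, 23]) = true ∧ isRotation [10, 12, 18, 23] = true ∧
    isTrivial (e.prodWord ++ wordT [18, 23] ++ e.prodWord ++ wordT [18, 23] ++
      (wordT [10, 12] ++ wordT [10, 12]) ++
      wordInv (fullTwist [10, 12, 18, 23])) = true := by
  apply Exists.intro
  apply And.intro
  · simp (decide := true) only [F₁, Z3l, branchPair_eq, Z_eq_eval, T_eq_eval, Z2_eq_toList, full_eq_eval, mul_eq_eval,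
      conj_eq_eval, cusps_eq_toList, conjList_eq_toList, append_eq_toList, singleton_eq_toList,
      cons_eq_toList]
    rfl
  · decide +kernel

theorem exists_factors_phi7 : ∃ e : Factors, phi7 = e.toList ∧
    e.all (isAmong [8, 9, 10, 12, 18, 23]) = true ∧ isRotation [8, 9, 10, 12, 18, 23] = true ∧
    isTrivial (e.prodWord ++ wordT ([8, 9] ++ [10, 12] ++ [18, 23]) ++
      wordInv (fullTwist [8, 9, 10, 12, 18, 23])) = true := by
  apply Exists.intro
  apply And.intro
  · simp (decide := true) only [phi7, phi7.G, twice, F₁, Z3l, Z3r, branchPair_eq, inv_eq_eval, sq_eq_eval, Z_eq_eval,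
      T_eq_eval, Z2_eq_toList, full_eq_eval, mul_eq_eval, conj_eq_eval, cusps_eq_toList,
      conjList_eq_toList, append_eq_toList, singleton_eq_toList, cons_eq_toList]
    rfl
  · decide +kernel

theorem exists_factors_F₃_13_15_16_18 : ∃ e : Factors, F₃ 13 15 16 18 = e.toList ∧
    e.all (isAmong [13, 15, 16, 18]) = true ∧ isRotation [13, 15, 16, 18] = true ∧
    isTrivial (e.prodWord ++ wordT [13, 18] ++ e.prodWord ++ wordT [13, 18] ++
      (wordT [15, 16] ++ wordT [15, 16]) ++
      wordInv (fullTwist [13, 15, 16, 18])) = true := by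
  apply Exists.intro
  apply And.intro
  · simp (decide := true) only [F₃, Z3l, Z3r, branchPair_eq, Z_eq_eval, T_eq_eval, Z2_eq_toList, full_eq_eval,
      mul_eq_eval, conj_eq_eval, cusps_eq_toList, conjList_eq_toList, append_eq_toList,
      singleton_eq_toList, cons_eq_toList]
    rfl
  · decide +kernel

theorem exists_factors_phi9 : ∃ e : Factors, phi9 = e.toList ∧
    e.all (isAmong [13, 14, 15, 16, 17, 18]) = true ∧ isRotation [13, 14, 15, 16, 17, 18] = true ∧
    isTrivial (e.prodWord ++ wordT ([14, 17] ++ [15, 16] ++ [13, 18]) ++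
      wordInv (fullTwist [13, 14, 15, 16, 17, 18])) = true := by
  apply Exists.intro
  apply And.intro
  · simp (decide := true) only [phi9, phi9.G, twice, F₃, Z3l, Z3r, Z3rbar, branchPair_eq, inv_eq_eval, Zbar_eq_eval,
      Z2bar_eq_toList, Z_eq_eval, T_eq_eval, Z2_eq_toList, full_eq_eval, mul_eq_eval,
      conj_eq_eval, cusps_eq_toList, conjList_eq_toList, append_eq_toList, singleton_eq_toList,
      cons_eq_toList]
    rfl
  · decide +kernel

theorem exists_factors_F₃_20_21_22_23 : ∃ e : Factors, F₃ 20 21 22 23 = e.toList ∧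
    e.all (isAmong [20, 21, 22, 23]) = true ∧ isRotation [20, 21, 22, 23] = true ∧
    isTrivial (e.prodWord ++ wordT [20, 23] ++ e.prodWord ++ wordT [20, 23] ++
      (wordT [21, 22] ++ wordT [21, 22]) ++
      wordInv (fullTwist [20, 21, 22, 23])) = true := by
  apply Exists.intro
  apply And.intro
  · simp (decide := true) only [F₃, Z3l, Z3r, branchPair_eq, Z_eq_eval, T_eq_eval, Z2_eq_toList, full_eq_eval,
      mul_eq_eval, conj_eq_eval, cusps_eq_toList, conjList_eq_toList, append_eq_toList,
      singleton_eq_toList, cons_eq_toList]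
    rfl
  · decide +kernel

theorem exists_factors_phi10 : ∃ e : Factors, phi10 = e.toList ∧
    e.all (isAmong [19, 20, 21, 22, 23, 24]) = true ∧ isRotation [19, 20, 21, 22, 23, 24] = true ∧
    isTrivial (e.prodWord ++ wordT ([19, 24] ++ [21, 22] ++ [20, 23]) ++
      wordInv (fullTwist [19, 20, 21, 22, 23, 24])) = true := by
  apply Exists.intro
  apply And.intro
  · simp (decide := true) only [phi10, phi10.G, twice, F₃, Z3l, Z3r, Z3rbar, Z3lbar, branchPair_eq, inv_eq_eval,
      Zbar_eq_eval, Z_eq_eval, T_eq_eval, Z2_eq_toList, full_eq_eval, mul_eq_eval, conj_eq_eval,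
      cusps_eq_toList, conjList_eq_toList, append_eq_toList, singleton_eq_toList,
      cons_eq_toList]
    rfl
  · decide +kernel

/-- The analogous identity at a 3-point, with the full twist of six points. -/
theorem exists_factors_phi3_1_3_19 : ∃ e : Factors, phi3 1 3 19 = e.toList ∧
    e.all (isAmong [1, 3, 19]) = true ∧ isRotation [1, 3, 19] = true ∧
    isTrivial (e.prodWord ++ wordT ([19] ++ [1] ++ [3]) ++
      wordInv (fullTwist [1, 3, 19])) = true := by
  apply Exists.intro
  apply And.intro
  · simp (decide := true) only [phi3, Z3l, Z_eq_eval, T_eq_eval, full_eq_eval, mul_eq_eval, cusps_eq_toList,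
      conjList_eq_toList, append_eq_toList, singleton_eq_toList, cons_eq_toList]
    rfl
  · decide +kernel

theorem exists_factors_phi3_2_6_14 : ∃ e : Factors, phi3 2 6 14 = e.toList ∧
    e.all (isAmong [2, 6, 14]) = true ∧ isRotation [2, 6, 14] = true ∧
    isTrivial (e.prodWord ++ wordT ([14] ++ [2] ++ [6]) ++
      wordInv (fullTwist [2, 6, 14])) = true := by
  apply Exists.intro
  apply And.intro
  · simp (decide := true) only [phi3, Z3l, Z_eq_eval, T_eq_eval, full_eq_eval, mul_eq_eval, cusps_eq_toList,
      conjList_eq_toList, append_eq_toList, singleton_eq_toList, cons_eq_toList]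
    rfl
  · decide +kernel

theorem exists_factors_phi3_7_10_17 : ∃ e : Factors, phi3 7 10 17 = e.toList ∧
    e.all (isAmong [7, 10, 17]) = true ∧ isRotation [7, 10, 17] = true ∧
    isTrivial (e.prodWord ++ wordT ([17] ++ [7] ++ [10]) ++
      wordInv (fullTwist [7, 10, 17])) = true := by
  apply Exists.intro
  apply And.intro
  · simp (decide := true) only [phi3, Z3l, Z_eq_eval, T_eq_eval, full_eq_eval, mul_eq_eval, cusps_eq_toList,
      conjList_eq_toList, append_eq_toList, singleton_eq_toList, cons_eq_toList]
    rfl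
  · decide +kernel

theorem exists_factors_phi3_11_12_24 : ∃ e : Factors, phi3 11 12 24 = e.toList ∧
    e.all (isAmong [11, 12, 24]) = true ∧ isRotation [11, 12, 24] = true ∧
    isTrivial (e.prodWord ++ wordT ([24] ++ [11] ++ [12]) ++
      wordInv (fullTwist [11, 12, 24])) = true := by
  apply Exists.intro
  apply And.intro
  · simp (decide := true) only [phi3, Z3l, Z_eq_eval, T_eq_eval, full_eq_eval, mul_eq_eval, cusps_eq_toList,
      conjList_eq_toList, append_eq_toList, singleton_eq_toList, cons_eq_toList]
    rfl
  · decide +kernel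

/-! ### Invariance of the local braid monodromies -/

section

attribute [local irreducible] T full Z2 Z2bar Z3l Z3lbar Z3r Z3rbar branchPair conjList invariance
  twice

-- The two pairs of lines inside `F`. Outside the doubled `F` all blocks and exponents are
-- compatible with each halftwist alone; on it the branch pair uses `twice_mem` and the other pair
-- the product identity.
set_option maxHeartbeats 4000000 in
theorem phi_mem_of_six :
    (T 1 * T 2 ∈ invariance phi2 ∧ T 13 * T 20 ∈ invariance phi2) ∧
    (T 15 * T 21 ∈ invariance phi4 ∧ T 3 * T 7 ∈ invariance phi4) ∧
    (T 16 * T 22 ∈ invariance phi5 ∧ T 6 * T 11 ∈ invariance phi5) ∧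
    (T 10 * T 12 ∈ invariance phi7 ∧ T 18 * T 23 ∈ invariance phi7) ∧
    (T 15 * T 16 ∈ invariance phi9 ∧ T 13 * T 18 ∈ invariance phi9) ∧
    (T 21 * T 22 ∈ invariance phi10 ∧ T 20 * T 23 ∈ invariance phi10) := by
  have c : ∀ {i j k : ℕ}, 1 ≤ i → 1 ≤ j → 1 ≤ k → Commute (T i) (T j * T k) :=
    fun hi hj hk => (commute_T hi hj).mul_right (commute_T hi hk)
  obtain ⟨_, e₂⟩ := exists_factors_F₁_1_2_13_20
  obtain ⟨_, e₄⟩ := exists_factors_F₂_3_7_15_21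
  obtain ⟨_, e₅⟩ := exists_factors_F₂_6_11_16_22
  obtain ⟨_, e₇⟩ := exists_factors_F₁_10_12_18_23
  obtain ⟨_, e₉⟩ := exists_factors_F₃_13_15_16_18
  obtain ⟨_, e₁₀⟩ := exists_factors_F₃_20_21_22_23
  have h₂ : T 1 * T 2 ∈ invariance (F₁ 1 2 13 20) := F₁_mem (by decide)
  have h₄ : T 15 * T 21 ∈ invariance (F₂ 3 7 15 21) := F₂_mem (by decide)
  have h₅ : T 16 * T 22 ∈ invariance (F₂ 6 11 16 22) := F₂_mem (by decide)
  have h₇ : T 10 * T 12 ∈ invariance (F₁ 10 12 18 23) := F₁_mem (by decide)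
  have h₉ : T 15 * T 16 ∈ invariance (F₃ 13 15 16 18) := F₃_mem (by decide)
  have h₁₀ : T 21 * T 22 ∈ invariance (F₃ 20 21 22 23) := F₃_mem (by decide)
  have t₂ := twice_mem_of_isTrivial e₂ h₂
  have t₄ := twice_mem_of_isTrivial e₄ h₄
  have t₅ := twice_mem_of_isTrivial e₅ h₅
  have t₇ := twice_mem_of_isTrivial e₇ h₇
  have t₉ := twice_mem_of_isTrivial e₉ h₉
  have t₁₀ := twice_mem_of_isTrivial e₁₀ h₁₀
  clear e₂ e₄ e₅ e₇ e₉ e₁₀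
  unfold phi2 phi2.G phi4 phi4.G phi5 phi5.G phi7 phi7.G phi9 phi9.G phi10 phi10.G
  refine ⟨⟨?_, ?_⟩, ⟨?_, ?_⟩, ⟨?_, ?_⟩, ⟨?_, ?_⟩, ⟨?_, ?_⟩, ⟨?_, ?_⟩⟩ <;> repeat' first
    | with_reducible apply append_mem_invariance
    | with_reducible apply conjList_mem_invariance
    | with_reducible assumption
    -- Again tried before products are split, since the doubled `F` is known to be invariant only
    -- under the joint halftwists.
    | exact twice_mem (by assumption) (c (by decide) (by decide) (by decide))
        (c (by decide) (by decide) (by decide))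
    | with_reducible apply mul_mem
    | with_reducible apply Commute.mul_right
    | with_reducible apply Commute.mul_left
    | with_reducible apply Commute.inv_left
    | with_reducible apply Commute.pow_left
    | exact Z3l_mem (by decide)
    | exact Z3r_mem (by decide)
    | exact Z3lbar_mem (by decide)
    | exact Z3rbar_mem (by decide)
    | exact Z3l_avoids (by decide)
    | exact Z3r_avoids (by decide)
    | exact Z3lbar_avoids (by decide)
    | exact Z3rbar_avoids (by decide)
    | exact Z2_left (by decide)
    | exact Z2_right (by decide)
    | exact Z2_avoids (by decide)
    | exact Z2bar_right (by decide)
    | exact Z2bar_avoids (by decide)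
    | exact singleton_T_mem (by decide)
    | exact commute_T (by decide) (by decide)
    | exact commute_full_left (by decide)
    | exact commute_full_right (by decide)
    | exact commute_full_dbl_left (by decide)
    | exact commute_full_dbl_right (by decide)
    | exact commute_full_avoids (by decide)

end

theorem T_mem_of_notMem {l : List B} {s : List ℕ} {e : Factors} (h1 : l = e.toList)
    (h2 : e.all (isAmong s) = true) (j : ℕ) (hj : 1 ≤ j) (hs : j ∉ s) : T j ∈ invariance l := by
  refine T_mem_of_all h1 h2 hj ?_ ?_ <;>
  · simp only [positions, List.mem_flatMap, List.mem_cons, List.not_mem_nil, or_false, u, v]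
    rintro ⟨k, hk, h⟩
    have : j = k := by omega
    exact hs (this ▸ hk)

theorem wordT_singleton (j : ℕ) : eval (wordT [j]) = T j := by
  simp [wordT, eval, evalLetter, T]

/-- Meant for the lines `i`, `j` that carry a single branch point each: two of three pairs cancel
from the full-twist identity. -/
theorem T_mem_of_three {l : List B} {a b c d i j : ℕ} {s : List ℕ} {e : Factors}
    (he : l = e.toList ∧ e.all (isAmong s) = true ∧ isRotation s = true ∧
      isTrivial (e.prodWord ++ wordT ([i, j] ++ [a, b] ++ [c, d]) ++ wordInv (fullTwist s)) = true)
    (h : T a * T b ∈ invariance l) (h' : T c * T d ∈ invariance l) :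
    T i * T j ∈ invariance l := by
  have := wordT_mem_of_isTrivial he
  rw [eval_wordT_append, eval_wordT_append, eval_wordT_pair, eval_wordT_pair,
    eval_wordT_pair] at this
  exact (Subgroup.mul_mem_cancel_right _ h).1 ((Subgroup.mul_mem_cancel_right _ h').1 this)

theorem phi3_mem {i j k : ℕ} (hi : 1 ≤ i) (hij : i < j) (hjk : j < k) (hk : k ≤ 24) :
    T i ∈ invariance (phi3 i j k) ∧ T j ∈ invariance (phi3 i j k) := by
  have h0 : 1 ≤ u i := by simp only [u]; omega
  have h1 : v i < u j := by simp only [u, v]; omega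
  have h2 : u i < u j := by simp only [u]; omega
  have h3 : u j ≤ 48 := by simp only [u]; omega
  have h4 : u j < v j := by simp only [u, v]; omega
  have h5 : v j ≤ 48 := by simp only [v]; omega
  have e1 : Z (v i) (u j) = conj (Z (u i) (u j)) (T i) := halfTwist_v_left hi h1 h3
  have e2 : Z (u i) (v j) = conj (Z (u i) (u j)) (T j) := halfTwist_v_right h0 h2
  have e3 : Z (v i) (v j) = conj (Z (u i) (v j)) (T i) := halfTwist_v_left hi (h1.trans h4) h5
  rw [e2, conj_conj] at e3
  -- The eight branch points are a regenerated node of two doubled lines in which every `z ^ 2` is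
  -- split into two factors `z`; the quadruple criterion only sees powers of `z` with product `z ^
  -- 2`.
  have q := (braided_halfTwist_T_right (above := fun _ => false) h0 h2
    (by omega)).quadruple_mem_invariance (braided_halfTwist_T_left hi h1 h3)
    (commute_T (by omega) hi) (l := [Z (u i) (u j), Z (u i) (u j)])
    (by simpa using ⟨1, (pow_one _).symm⟩) (by simp [pow_two]; rfl)
  have e : ∀ {h : B}, h ∈ invariance (conjList [Z (u i) (u j), Z (u i) (u j)] (T j * T i) ++
      conjList [Z (u i) (u j), Z (u i) (u j)] (T j) ++
      (conjList [Z (u i) (u j), Z (u i) (u j)] (T i) ++ [Z (u i) (u j), Z (u i) (u j)])) →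
      h ∈ invariance [Z (v i) (v j), Z (v i) (v j), Z (u i) (v j), Z (u i) (v j),
      Z (v i) (u j), Z (v i) (u j), Z (u i) (u j), Z (u i) (u j)] := by
    intro h hh
    simpa [conjList, e1, e2, e3] using hh
  have c₁ : Commute (full (dbl j) (pt k)) (T i) :=
    commute_full_avoids (by simp [dbl, pt, Avoids, u, v]; omega)
  have c₂ : Commute (full (dbl j) (pt k)) (T j) :=
    commute_full_left (by simp only [u, v]; omega)
  have c₃ : Commute (full (dbl i) (pt k)) (T i) :=
    commute_full_left (by simp only [u, v]; omega)
  have c₄ : Commute (full (dbl i) (pt k)) (T j) :=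
    commute_full_avoids (by simp [dbl, pt, Avoids, u, v]; omega)
  constructor
  · exact append_mem_invariance (append_mem_invariance (append_mem_invariance
      (Z3l_avoids (by simp only [Avoids, u, v]; omega)) (conjList_mem_invariance (e q.2) c₁))
      (Z3l_mem (by simp only [u, v]; omega)))
      (conjList_mem_invariance (singleton_T_mem (by omega)) (c₁.mul_left c₃))
  · exact append_mem_invariance (append_mem_invariance (append_mem_invariance
      (Z3l_mem (by simp only [u, v]; omega)) (conjList_mem_invariance (e q.1) c₂))
      (Z3l_avoids (by simp only [Avoids, u, v]; omega)))
      (conjList_mem_invariance (singleton_T_mem (by omega)) (c₂.mul_left c₄))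

/-- The third line `k` enters through single points, so `T k` comes from the product. At a 3-point
all halftwists are obtained individually, so every factor of ρ is. -/
theorem T_mem_phi3 {i j k : ℕ} {e : Factors} (hi : 1 ≤ i) (hij : i < j) (hjk : j < k)
    (hk : k ≤ 24)
    (he : phi3 i j k = e.toList ∧ e.all (isAmong [i, j, k]) = true ∧ isRotation [i, j, k] = true ∧
      isTrivial (e.prodWord ++ wordT ([k] ++ [i] ++ [j]) ++ wordInv (fullTwist [i, j, k])) = true)
    (s : ℕ) (hs : 1 ≤ s) : T s ∈ invariance (phi3 i j k) := by
  obtain ⟨h₁, h₂⟩ := phi3_mem hi hij hjk hk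
  have := wordT_mem_of_isTrivial he
  rw [eval_wordT_append, eval_wordT_append, wordT_singleton, wordT_singleton,
    wordT_singleton] at this
  have h₃ := (Subgroup.mul_mem_cancel_right _ h₁).1 ((Subgroup.mul_mem_cancel_right _ h₂).1 this)
  by_cases h : s ∈ [i, j, k]
  · simp only [List.mem_cons, List.not_mem_nil, or_false] at h
    rcases h with rfl | rfl | rfl
    exacts [h₁, h₂, h₃]
  · exact T_mem_of_notMem he.1 he.2.1 s hs h

/-! ### Invariance of the parasitic intersections -/

/-- Lines with the same larger vertex are numbered consecutively and meet each other, so every path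
of `D t` starts to the left of the points it has to pass above. -/
theorem lt_firstMate : ∀ t < 25, firstMate t ≤ t ∧ ∀ i ∈ disjointLines t, 1 ≤ i ∧ i < firstMate t := by
  decide

/-- A line is an end of the path, or both its points lie on the same side of it; so each `T s` acts
individually. -/
theorem T_mem_nodes {t i s : ℕ} (ht : t < 25) (hs : 1 ≤ s) (hi : i ∈ disjointLines t) :
    T s ∈ invariance (nodesAlong (mateBefore t) (dbl i) (dbl t)) ∧
      T s ∈ invariance (nodesAlong (fun k => !mateBefore t k) (dbl i).reverse (dbl t).reverse) := by
  obtain ⟨h0, h⟩ := lt_firstMate t ht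
  obtain ⟨h1, h2⟩ := h i hi
  have e1 : mateBefore t (v i) = false := by simp [mateBefore, u, v]; omega
  have e2 : mateBefore t (u t) = false := by simp [mateBefore]
  have d := nodesAlong_dbl (above := mateBefore t) h1 (by omega) (by omega) e1 e2
  have d' := nodesAlong_dbl_reverse (above := fun k => !mateBefore t k) (i := i) (j := t) h1
    (by omega) (by omega) (by simp [e1]) (by simp [e2])
  by_cases hsi : s = i
  · subst hsi; exact ⟨d.1, d'.1⟩
  by_cases hst : s = t
  · subst hst; exact ⟨d.2, d'.2⟩
  have e3 : mateBefore t (u s) = mateBefore t (v s) := by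
    unfold mateBefore
    rw [← Bool.decide_and, ← Bool.decide_and, decide_eq_decide]
    simp only [u, v]
    omega
  exact ⟨nodesAlong_avoids (by simp [dbl, Avoids, u, v]; omega) e3,
    nodesAlong_avoids (by simp [dbl, Avoids, u, v]; omega) (by rw [e3])⟩

theorem linesFrom_lt (j t : ℕ) (ht : t ∈ linesFrom j) : t < 25 := by
  unfold linesFrom at ht
  split at ht <;> simp at ht <;> omega

theorem T_mem_C (j s : ℕ) (hs : 1 ≤ s) : T s ∈ invariance (C j) ∧ T s ∈ invariance (Cbar j) :=
  ⟨flatMap_mem_invariance fun t ht => flatMap_mem_invariance fun _ hi =>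
    (T_mem_nodes (linesFrom_lt j t ht) hs hi).1,
  flatMap_mem_invariance fun t ht => flatMap_mem_invariance fun _ hi =>
    (T_mem_nodes (linesFrom_lt j t ht) hs hi).2⟩

/-! ### Invariance of the factorization -/

/-- The product of the halftwists of four lines belongs to a subgroup if this is so for two lines
together and for each of the other two lines. -/
theorem four_mem {H : Subgroup B} {a b c d : ℕ} (h : 1 ≤ a ∧ 1 ≤ b ∧ 1 ≤ c ∧ 1 ≤ d)
    (h' : (T a * T b ∈ H ∧ T c ∈ H ∧ T d ∈ H) ∨ (T c * T d ∈ H ∧ T a ∈ H ∧ T b ∈ H) ∨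
      (T a * T c ∈ H ∧ T b ∈ H ∧ T d ∈ H) ∨ (T b * T d ∈ H ∧ T a ∈ H ∧ T c ∈ H) ∨
      (T a ∈ H ∧ T b ∈ H ∧ T c ∈ H ∧ T d ∈ H)) :
    T a * T b * T c * T d ∈ H := by
  rcases h' with ⟨h1, h2, h3⟩ | ⟨h1, h2, h3⟩ | ⟨h1, h2, h3⟩ | ⟨h1, h2, h3⟩ |
    ⟨h1, h2, h3, h4⟩
  · exact mul_mem (mul_mem h1 h2) h3
  · rw [mul_assoc]
    exact mul_mem (mul_mem h2 h3) h1
  · rw [mul_assoc (T a), (commute_T h.2.1 h.2.2.1).eq, ← mul_assoc]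
    exact mul_mem (mul_mem h1 h2) h3
  · rw [mul_assoc (T a), (commute_T h.2.1 h.2.2.1).eq, ← mul_assoc, mul_assoc]
    exact mul_mem (mul_mem h2 h3) h1
  · exact mul_mem (mul_mem (mul_mem h1 h2) h3) h4

/-- The braids whose powers are the factors of `ρ`. -/
def generators : List B :=
  [T 1 * T 2, T 6 * T 11, T 10 * T 12, T 3 * T 7, T 14 * T 17, T 19 * T 24,
    T 4 * T 5 * T 8 * T 9, T 13 * T 18 * T 20 * T 23, T 15 * T 16 * T 21 * T 22]

section

attribute [local irreducible] T invariance

theorem generators_subset {H : Subgroup B} (h : ∀ s, 1 ≤ s → T s ∈ H) :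
    ∀ g ∈ generators, g ∈ H := by
  simp only [generators, List.forall_mem_cons, List.not_mem_nil, false_imp_iff, implies_true,
    and_true]
  refine ⟨?_, ?_, ?_, ?_, ?_, ?_, ?_, ?_, ?_⟩ <;> repeat' first
    | exact h _ (by decide)
    | with_reducible apply mul_mem

/-- A line that is absent from a 6-point contributes its halftwist alone. The lines of a generator
that are present form one of the three pairs there, whose joint halftwist is known. -/
theorem generators_subset_phi :
    (∀ g ∈ generators, g ∈ invariance phi2) ∧ (∀ g ∈ generators, g ∈ invariance phi4) ∧
    (∀ g ∈ generators, g ∈ invariance phi5) ∧ (∀ g ∈ generators, g ∈ invariance phi7) ∧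
    (∀ g ∈ generators, g ∈ invariance phi9) ∧ (∀ g ∈ generators, g ∈ invariance phi10) := by
  obtain ⟨⟨a₂, b₂⟩, ⟨a₄, b₄⟩, ⟨a₅, b₅⟩, ⟨a₇, b₇⟩, ⟨a₉, b₉⟩, ⟨a₁₀, b₁₀⟩⟩ := phi_mem_of_six
  obtain ⟨_, e₂⟩ := exists_factors_phi2
  obtain ⟨_, e₄⟩ := exists_factors_phi4
  obtain ⟨_, e₅⟩ := exists_factors_phi5
  obtain ⟨_, e₇⟩ := exists_factors_phi7
  obtain ⟨_, e₉⟩ := exists_factors_phi9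
  obtain ⟨_, e₁₀⟩ := exists_factors_phi10
  have c₂ := T_mem_of_three e₂ a₂ b₂
  have c₄ := T_mem_of_three e₄ a₄ b₄
  have c₅ := T_mem_of_three e₅ a₅ b₅
  have c₇ := T_mem_of_three e₇ a₇ b₇
  have c₉ := T_mem_of_three e₉ a₉ b₉
  have c₁₀ := T_mem_of_three e₁₀ a₁₀ b₁₀
  have d₂ := T_mem_of_notMem e₂.1 e₂.2.1
  have d₄ := T_mem_of_notMem e₄.1 e₄.2.1
  have d₅ := T_mem_of_notMem e₅.1 e₅.2.1
  have d₇ := T_mem_of_notMem e₇.1 e₇.2.1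
  have d₉ := T_mem_of_notMem e₉.1 e₉.2.1
  have d₁₀ := T_mem_of_notMem e₁₀.1 e₁₀.2.1
  clear e₂ e₄ e₅ e₇ e₉ e₁₀
  simp only [generators, List.forall_mem_cons, List.not_mem_nil, false_imp_iff, implies_true,
    and_true]
  generalize invariance phi2 = H₂ at *
  generalize invariance phi4 = H₄ at *
  generalize invariance phi5 = H₅ at *
  generalize invariance phi7 = H₇ at *
  generalize invariance phi9 = H₉ at *
  generalize invariance phi10 = H₁₀ at *
  refine ⟨?_, ?_, ?_, ?_, ?_, ?_⟩ <;> refine ⟨?_, ?_, ?_, ?_, ?_, ?_, ?_, ?_, ?_⟩ <;> first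
    | assumption
    | exact mul_mem (by simp [*]) (by simp [*])
    | exact four_mem (by decide) (by simp [*])

end

theorem generators_subset_C_phi (j : ℕ) :
    ∀ g ∈ generators, g ∈ invariance (C j ++ phi j) ∧ g ∈ invariance (Cbar j ++ phi j) := by
  have key : ∀ g ∈ generators, g ∈ invariance (phi j) := by
    obtain ⟨h₂, h₄, h₅, h₇, h₉, h₁₀⟩ := generators_subset_phi
    obtain ⟨_, e₁⟩ := exists_factors_phi3_1_3_19
    obtain ⟨_, e₃⟩ := exists_factors_phi3_2_6_14
    obtain ⟨_, e₆⟩ := exists_factors_phi3_7_10_17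
    obtain ⟨_, e₈⟩ := exists_factors_phi3_11_12_24
    unfold phi
    split
    · exact generators_subset (T_mem_phi3 (by decide) (by decide) (by decide) (by decide) e₁)
    · exact h₂
    · exact generators_subset (T_mem_phi3 (by decide) (by decide) (by decide) (by decide) e₃)
    · exact h₄
    · exact h₅
    · exact generators_subset (T_mem_phi3 (by decide) (by decide) (by decide) (by decide) e₆)
    · exact h₇
    · exact generators_subset (T_mem_phi3 (by decide) (by decide) (by decide) (by decide) e₈)
    · exact h₉
    · exact h₁₀
    · exact fun g _ => mem_invariance_of_commute (by simp)
  exact fun g hg =>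
    ⟨append_mem_invariance (generators_subset (fun s hs => (T_mem_C j s hs).1) g hg) (key g hg),
      append_mem_invariance (generators_subset (fun s hs => (T_mem_C j s hs).2) g hg) (key g hg)⟩

theorem product_mem {H : Subgroup B} (h : ∀ g ∈ generators, g ∈ H)
    (m₁ m₆ m₁₀ m₃ m₁₄ m₁₉ m₄ m₁₃ m₁₅ : ℤ) :
    (T 1 * T 2) ^ m₁ * (T 6 * T 11) ^ m₆ * (T 10 * T 12) ^ m₁₀ * (T 3 * T 7) ^ m₃ *
      (T 14 * T 17) ^ m₁₄ * (T 19 * T 24) ^ m₁₉ * (T 4 * T 5 * T 8 * T 9) ^ m₄ *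
      (T 13 * T 18 * T 20 * T 23) ^ m₁₃ * (T 15 * T 16 * T 21 * T 22) ^ m₁₅ ∈ H := by
  simp only [generators, List.forall_mem_cons, List.not_mem_nil, false_imp_iff, implies_true,
    and_true] at h
  obtain ⟨h₁, h₂, h₃, h₄, h₅, h₆, h₇, h₈, h₉⟩ := h
  exact mul_mem (mul_mem (mul_mem (mul_mem (mul_mem (mul_mem (mul_mem (mul_mem (zpow_mem h₁ _)
    (zpow_mem h₂ _)) (zpow_mem h₃ _)) (zpow_mem h₄ _)) (zpow_mem h₅ _)) (zpow_mem h₆ _))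
    (zpow_mem h₇ _)) (zpow_mem h₈ _)) (zpow_mem h₉ _)

end K3Braid

theorem mainTheorem5 (m₁ m₆ m₁₀ m₃ m₁₄ m₁₉ m₄ m₁₃ m₁₅ : ℤ) (ρ : K3Braid.B)
    (hρ : ρ =
      (K3Braid.T 1 * K3Braid.T 2) ^ m₁ * (K3Braid.T 6 * K3Braid.T 11) ^ m₆ *
      (K3Braid.T 10 * K3Braid.T 12) ^ m₁₀ * (K3Braid.T 3 * K3Braid.T 7) ^ m₃ *
      (K3Braid.T 14 * K3Braid.T 17) ^ m₁₄ * (K3Braid.T 19 * K3Braid.T 24) ^ m₁₉ *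
      (K3Braid.T 4 * K3Braid.T 5 * K3Braid.T 8 * K3Braid.T 9) ^ m₄ *
      (K3Braid.T 13 * K3Braid.T 18 * K3Braid.T 20 * K3Braid.T 23) ^ m₁₃ *
      (K3Braid.T 15 * K3Braid.T 16 * K3Braid.T 21 * K3Braid.T 22) ^ m₁₅) :
    K3Braid.IsInvariantUnder K3Braid.delta48 ρ ∧
      K3Braid.IsInvariantUnder K3Braid.delta48bar ρ := by
  rw [hρ]
  exact ⟨K3Braid.product_mem (H := K3Braid.invariance K3Braid.delta48) (fun g hg =>
      K3Braid.flatMap_mem_invariance fun j _ => (K3Braid.generators_subset_C_phi j g hg).1) ..,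
    K3Braid.product_mem (H := K3Braid.invariance K3Braid.delta48bar) (fun g hg =>
      K3Braid.flatMap_mem_invariance fun j _ => (K3Braid.generators_subset_C_phi j g hg).2) ..⟩
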